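/- \textbf{Setting.} Let $\mathcal H_S$ be a complex Hilbert space, $D\in\mathbf B(\mathcal H_S)$, $D_0=D$, $D_1=D^+$, and let $\omega_0\in\mathbb R$ (the frequency of the rotating wave condition $e^{itH_S}De^{-itH_S}=e^{-it\omega_0}D$). Let $\mathcal H_1=L^2(\mathbb R^d)$, let $H_1$ be multiplication by a measurable function $\omega:\mathbb R^d\to\mathbb R$ that is bounded below, $\beta>0$, $L=e^{-\beta H_1/2}$. Let $P_0$ be an orthogonal projection on $\mathcal H_1$ that commutes with $H_1$, and let $g_0,g_1\in\mathcal H_1$ satisfy $P_0g_0=g_0$, $P_0g_1=0$. Put $S_t=e^{itH_1}e^{-it\omega_0P_0}=e^{it(H_1-\omega_0P_0)}$. Let $K\subset\mathcal H_1$ be a linear subspace of the closed span of $\{S_tg_\varepsilon: t\in\mathbb R,\ \varepsilon=0,1\}$ with $g_0,g_1\in K$ and $\int_{\mathbb R}|\langle f,S_tf'\rangle|\,dt<\infty$ for all $f,f'\in K$. Write, in the sense of matrix elements, $P_E=\frac1{2\pi}\int_{\mathbb R}S_te^{-itE}\,dt$, that is $$\langle f,P_Ef'\rangle=\frac1{2\pi}\int_{\mathbb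 R}\langle f,S_tf'\rangle e^{-itE}\,dt ,\qquad \gamma_\varepsilon(E)=\int_{-\infty}^0\langle g_\varepsilon,S_tg_\varepsilon\rangle e^{-itE}\,dt .$$ Assume that the inverse $T_\varepsilon(E)=\bigl(1+\gamma_\varepsilon(E)\gamma_{1-\varepsilon}(E)D_\varepsilon D_{1-\varepsilon}\bigr)^{-1}\in\mathbf B(\mathcal H_S)$ exists for all $E\in\mathbb R$ and $\varepsilon\in\{0,1\}$. Put $n_\varepsilon(E)=1/\langle g_\varepsilon,P_EL^2g_\varepsilon\rangle$ (and $n_\varepsilon(E)=0$ where the denominator vanishes). Let $K\otimes_\beta K$ be the Hilbert space completion of $K\otimes K^*$ for $(f_0\otimes_\beta f_1|f_0'\otimes_\beta f_1')=\int_{\mathbb R}\langle f_0,S_tf_0'\rangle\overline{\langle f_1,S_tL^2f_1'\rangle}\,dt$, let $\mathcal F$ be the Boson Fock space over $L^2(\mathbb R)\otimes(K\otimes_\beta K)$ with exponential vectors $\psi(f)$, $\langle\psi(f),\psi(f')\rangle=e^{\langle f,f'\rangle}$, and vacuum $\Omega=\psi(0)$, and let $b_t$, $b_t^+$ be the white noise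 operators on it, $b_t(h)\psi(f)=\langle h|f(t)\rangle\psi(f)$. Put $B_{\varepsilon,\varepsilon'}(E,t)=b_t(g_\varepsilon\otimes_\beta P_Eg_{\varepsilon'})$. The limiting evolution operator is a family $(U_t)_{t\ge0}$ of bounded operators on $\mathcal H_S\otimes\mathcal F$ that solves the normally ordered equation $$\begin{aligned}\partial_tU_t=-\sum_{\varepsilon=0,1}\int dE\Bigl\{&iT_\varepsilon(E)D_\varepsilon\sum_{\varepsilon'}n_{\varepsilon'}(E)B^+_{\varepsilon,\varepsilon'}(E,t)U_tB_{1-\varepsilon,\varepsilon'}(E,t)\\ &+\gamma_{1-\varepsilon}(E)D_\varepsilon D_{1-\varepsilon}T_\varepsilon(E)\sum_{\varepsilon'}n_{\varepsilon'}(E)B^+_{\varepsilon,\varepsilon'}(E,t)U_tB_{\varepsilon,\varepsilon'}(E,t)\\ &+iT_\varepsilon(E)D_\varepsilon B^+_{\varepsilon,1-\varepsilon}(E,t)U_t+\gamma_{1-\varepsilon}(E)D_\varepsilon D_{1-\varepsilon}T_\varepsilon(E)B^+_{\varepsilon,\varepsilon}(E,t)U_t\\ &+iT_\varepsilon(E)D_\varepsilon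 U_tB_{1-\varepsilon,\varepsilon}(E,t)+\gamma_{1-\varepsilon}(E)D_\varepsilon D_{1-\varepsilon}T_\varepsilon(E)U_tB_{\varepsilon,\varepsilon}(E,t)\\ &+\gamma_{1-\varepsilon}(E)D_\varepsilon D_{1-\varepsilon}T_\varepsilon(E)\langle g_\varepsilon,P_EL^2g_\varepsilon\rangle U_t\Bigr\},\qquad U_0=1,\end{aligned}$$ in the sense of matrix elements (integrated in time) between vectors $u\otimes\psi(f)$ and $v\otimes\psi(f')$, where $u,v\in\mathcal H_S$ and $f,f'$ are finite sums of terms $\varphi\otimes(f_0\otimes_\beta f_1)$ with $\varphi\in C_c(\mathbb R)$, $f_0,f_1\in K$. Its vacuum expectation $\langle U(t)\rangle_{vac}\in\mathbf B(\mathcal H_S)$ is defined by $\langle u,\langle U(t)\rangle_{vac}v\rangle=\langle u\otimes\Omega,U_t(v\otimes\Omega)\rangle$. \textbf{Statement.} For every such $(U_t)_{t\ge 0}$: (a) the integrals in $$\Gamma=\sum_{\varepsilon=0,1}\int dE\,\gamma_{1-\varepsilon}(E)D_\varepsilon D_{1-\varepsilon}T_\varepsilon(E)\langle g_\varepsilon,P_EL^2g_\varepsilon\rangle$$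 converge absolutely in $\mathbf B(\mathcal H_S)$, so that $\Gamma$ is a bounded operator on $\mathcal H_S$; (b) $\langle U(t)\rangle_{vac}=e^{-\Gamma t}$ for all $t\ge0$; (c) the expectation is damped: $\Gamma$ has non-negative real part, $\mathrm{Re}\langle u,\Gamma u\rangle\ge0$ for all $u\in\mathcal H_S$; and it decays exponentially when the coupling does not degenerate: if $g_0\ne0$, $g_1\ne0$ and $\|D_0u\|+\|D_1u\|\ge\delta\|u\|$ for some $\delta>0$ and all $u\in\mathcal H_S$, then there is $c>0$ with $\|\langle U(t)\rangle_{vac}\|\le e^{-ct}$ for all $t\ge0$. -/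

import Mathlib

noncomputable section
namespace LowDensity
open MeasureTheory Complex Matrix
open scoped ComplexConjugate InnerProductSpace ComplexOrder TensorProduct CompactlySupported

section Kernel
variable {X : Type}

/-- Finitely supported functions on `X`, with the sesquilinear form that extends the kernel `k`. -/
def KernelFree (k : Matrix X X ℂ) (_hk : k.PosSemidef) : Type := X →₀ ℂ

variable (k : Matrix X X ℂ) (hk : k.PosSemidef)

instance : AddCommGroup (KernelFree k hk) := inferInstanceAs (AddCommGroup (X →₀ ℂ))

instance : Module ℂ (KernelFree k hk) := inferInstanceAs (Module ℂ (X →₀ ℂ))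

/-- The form `⟨c, c'⟩ = ∑ conj (c x) * k x y * c' y`. -/
def kernelForm (k : Matrix X X ℂ) (c c' : X →₀ ℂ) : ℂ :=
  c.sum fun x a => c'.sum fun y b => conj a * k x y * b

variable {k} in
lemma kernelForm_conj_symm (hk : k.PosSemidef) (c c' : X →₀ ℂ) :
    conj (kernelForm k c' c) = kernelForm k c c' := by
  unfold kernelForm
  rw [Finsupp.sum_comm]
  simp only [map_finsuppSum]
  refine Finsupp.sum_congr fun x _ => Finsupp.sum_congr fun y _ => ?_
  have h := hk.1.apply x y
  simp only [RCLike.star_def] at h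
  simp only [map_mul, h, Complex.conj_conj]
  ring

lemma kernelForm_add_left (c c' c'' : X →₀ ℂ) :
    kernelForm k (c + c') c'' = kernelForm k c c'' + kernelForm k c' c'' := by
  refine Finsupp.sum_add_index' (fun x => ?_) fun x a b => ?_
  · simp
  · simp [add_mul, Finsupp.sum_add]

lemma kernelForm_smul_left (c c' : X →₀ ℂ) (r : ℂ) :
    kernelForm k (r • c) c' = conj r * kernelForm k c c' := by
  refine (Finsupp.sum_smul_index (fun x => ?_)).trans ?_
  · simp
  · simp only [kernelForm, Finsupp.mul_sum]
    refine Finsupp.sum_congr fun x _ => Finsupp.sum_congr fun y _ => ?_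
    simp only [map_mul]; ring

instance : PreInnerProductSpace.Core ℂ (KernelFree k hk) where
  inner c c' := kernelForm k c c'
  conj_inner_symm c c' := kernelForm_conj_symm hk c c'
  re_inner_nonneg c := (Complex.nonneg_iff.1 (hk.2 c)).1
  add_left c c' c'' := kernelForm_add_left k c c' c''
  smul_left c c' r := kernelForm_smul_left k c c' r

instance : SeminormedAddCommGroup (KernelFree k hk) :=
  InnerProductSpace.Core.toSeminormedAddCommGroup (𝕜 := ℂ)

instance : InnerProductSpace ℂ (KernelFree k hk) := .ofCore _

/-- The Hilbert space of a positive semidefinite kernel `k` on `X`: the Hausdorff completion of the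
vector space with basis `X` for the sesquilinear form that extends `k`. -/
abbrev KernelSpace : Type := UniformSpace.Completion (KernelFree k hk)

/-- The basis vector of `x`. -/
def KernelFree.single (x : X) : KernelFree k hk := (Finsupp.single x 1 : X →₀ ℂ)

/-- The canonical map from `X` to the Hilbert space of the kernel. -/
def KernelSpace.vec (x : X) : KernelSpace k hk :=
  (KernelFree.single k hk x : KernelSpace k hk)

lemma KernelSpace.inner_vec (x y : X) :
    ⟪KernelSpace.vec k hk x, KernelSpace.vec k hk y⟫_ℂ = k x y := by
  unfold KernelSpace.vec
  rw [UniformSpace.Completion.inner_coe]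
  show kernelForm k (Finsupp.single x 1) (Finsupp.single y 1) = _
  simp [kernelForm]

lemma gram_posSemidef {V : Type*} [NormedAddCommGroup V] [InnerProductSpace ℂ V] (v : X → V) :
    (Matrix.of fun x y => ⟪v x, v y⟫_ℂ : Matrix X X ℂ).PosSemidef := by
  refine ⟨?_, fun c => ?_⟩
  · ext x y; simp
  · have : (c.sum fun i ci => c.sum fun j cj => star ci * ⟪v i, v j⟫_ℂ * cj)
        = ⟪c.sum fun i ci => ci • v i, c.sum fun i ci => ci • v i⟫_ℂ := by
      rw [Finsupp.sum_inner]
      refine Finsupp.sum_congr fun i _ => ?_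
      rw [Finsupp.inner_sum]
      refine Finsupp.sum_congr fun j _ => ?_
      rw [inner_smul_right, inner_smul_left]; simp only [RCLike.star_def]; ring
    simp only [Matrix.of_apply]
    rw [this]
    rw [inner_self_eq_norm_sq_to_K]
    norm_cast
    positivity

lemma posSemidef_of_tendsto {A : ℕ → Matrix X X ℂ} {B : Matrix X X ℂ}
    (hA : ∀ n, (A n).PosSemidef)
    (h : ∀ x y, Filter.Tendsto (fun n => A n x y) Filter.atTop (nhds (B x y))) :
    B.PosSemidef := by
  refine ⟨?_, fun c => ?_⟩
  · ext x y
    refine tendsto_nhds_unique ?_ (h x y)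
    have := (h y x).star
    refine this.congr fun n => ?_
    exact (hA n).1.apply x y
  · refine ge_of_tendsto' (x := Filter.atTop)
      (f := fun n => c.sum fun i ci => c.sum fun j cj => star ci * A n i j * cj) ?_
      fun n => (hA n).2 c
    exact tendsto_finsetSum _ fun i _ => tendsto_finsetSum _ fun j _ =>
      ((h i j).const_mul _).mul_const _

lemma exp_posSemidef {k : Matrix X X ℂ} (hk : k.PosSemidef) :
    (Matrix.of fun x y => Complex.exp (k x y) : Matrix X X ℂ).PosSemidef := by
  have hpow : ∀ n : ℕ, (Matrix.of fun x y => k x y ^ n : Matrix X X ℂ).PosSemidef := by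
    intro n
    induction n with
    | zero =>
      have := gram_posSemidef (X := X) (V := ℂ) (fun _ => 1)
      convert this using 3
      simp
    | succ n ih =>
      have := ih.hadamard hk
      have e : (Matrix.of fun x y => k x y ^ (n + 1) : Matrix X X ℂ)
          = Matrix.hadamard (Matrix.of fun x y => k x y ^ n) k := by
        ext x y; simp [pow_succ]
      rw [e]; exact this
  have hsum : ∀ n : ℕ, (Matrix.of fun x y => ∑ i ∈ Finset.range n,
      k x y ^ i / (i.factorial : ℂ) : Matrix X X ℂ).PosSemidef := by
    intro n
    induction n with
    | zero => simpa using! Matrix.PosSemidef.zero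
    | succ n ih =>
      have h2 := (hpow n).smul (a := ((n.factorial : ℝ)⁻¹ : ℝ)) (by positivity)
      have := ih.add h2
      convert this using 1
      ext x y
      simp [Finset.sum_range_succ, div_eq_inv_mul]
  refine posSemidef_of_tendsto hsum fun x y => ?_
  have := NormedSpace.expSeries_div_hasSum_exp (k x y)
  rw [← Complex.exp_eq_exp_ℂ] at this
  exact this.tendsto_sum_nat

end Kernel

section PositiveType
variable {H : Type*} [NormedAddCommGroup H] [InnerProductSpace ℂ H]

lemma continuous_of_inner_eq {v : ℝ → H} {φ : ℝ → ℂ} (hv : ∀ s t, ⟪v s, v t⟫_ℂ = φ (t - s))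
    (hφ : Continuous φ) : Continuous v := by
  have h : ∀ s t, ‖v t - v s‖ ^ 2 = 2 * (φ 0).re - 2 * (φ (t - s)).re := by
    intro s t
    have h1 : ∀ t, ‖v t‖ ^ 2 = (φ 0).re := by
      intro t
      have := hv t t
      rw [sub_self] at this
      rw [← this, ← inner_self_eq_norm_sq (𝕜 := ℂ)]
      rfl
    rw [@norm_sub_sq ℂ, h1, h1, ← inner_conj_symm, hv]
    simp
    ring
  rw [continuous_iff_continuousAt]
  intro s
  rw [ContinuousAt, tendsto_iff_norm_sub_tendsto_zero]
  have h2 : Filter.Tendsto (fun t => ‖v t - v s‖ ^ 2) (nhds s) (nhds 0) := by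
    simp only [h]
    have : Continuous fun t => 2 * (φ 0).re - 2 * (φ (t - s)).re := by fun_prop
    simpa using this.tendsto s
  have := h2.sqrt
  simpa [Real.sqrt_sq (norm_nonneg _)] using this

lemma integral_nonneg_of_inner_eq [CompleteSpace H] {v : ℝ → H} {φ : ℝ → ℂ}
    (hv : ∀ s t, ⟪v s, v t⟫_ℂ = φ (t - s)) (hφ : Continuous φ) (hi : Integrable φ) :
    0 ≤ ∫ t, φ t := by
  have hvc := continuous_of_inner_eq hv hφ
  have hb : ∀ t, ‖v t‖ = ‖v 0‖ := by
    intro t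
    have h1 := hv t t
    rw [sub_self, ← sub_self (0 : ℝ), ← hv, inner_self_eq_norm_sq_to_K,
      inner_self_eq_norm_sq_to_K] at h1
    have h2 : ‖v t‖ ^ 2 = ‖v 0‖ ^ 2 := by exact_mod_cast h1
    exact (sq_eq_sq₀ (norm_nonneg _) (norm_nonneg _)).1 h2
  have key : ∀ a : ℝ, 0 < a → 0 ≤ ∫ r, φ r * (Real.exp (-(a / 2) * r ^ 2) : ℂ) := by
    intro a ha
    have hw : Integrable fun s : ℝ => Real.exp (-a * s ^ 2) := integrable_exp_neg_mul_sq ha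
    have hwv : Integrable fun s : ℝ => (Real.exp (-a * s ^ 2) : ℂ) • v s :=
      hw.ofReal.smul_bdd ‖v 0‖ hvc.aestronglyMeasurable (.of_forall fun t => (hb t).le)
    have hC : 0 < ∫ t : ℝ, Real.exp (-(2 * a) * t ^ 2) := by
      rw [integral_gaussian]; positivity
    have hW : ∀ r : ℝ, ∫ t : ℝ, Real.exp (-a * t ^ 2) * Real.exp (-a * (t - r) ^ 2)
        = Real.exp (-(a / 2) * r ^ 2) * ∫ t : ℝ, Real.exp (-(2 * a) * t ^ 2) := by
      intro r
      rw [← integral_const_mul, ← integral_sub_right_eq_self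
        (fun t : ℝ => Real.exp (-(a / 2) * r ^ 2) * Real.exp (-(2 * a) * t ^ 2)) (r / 2)]
      congr 1
      ext t
      rw [← Real.exp_add, ← Real.exp_add]
      congr 1; ring
    have h1 : (0 : ℂ) ≤ ⟪∫ s : ℝ, (Real.exp (-a * s ^ 2) : ℂ) • v s,
        ∫ s : ℝ, (Real.exp (-a * s ^ 2) : ℂ) • v s⟫_ℂ := by
      rw [inner_self_eq_norm_sq_to_K]
      norm_cast
      positivity
    have h2 : ⟪∫ s : ℝ, (Real.exp (-a * s ^ 2) : ℂ) • v s,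
        ∫ s : ℝ, (Real.exp (-a * s ^ 2) : ℂ) • v s⟫_ℂ
        = ∫ t : ℝ, ∫ r : ℝ, ((Real.exp (-a * t ^ 2) * Real.exp (-a * (t - r) ^ 2) : ℝ) : ℂ)
          * φ r := by
      rw [← integral_inner hwv]
      congr 1
      ext t
      rw [inner_smul_right, ← inner_conj_symm, ← integral_inner hwv, ← integral_conj,
        ← integral_const_mul, ← integral_sub_left_eq_self _ _ t]
      congr 1
      ext r
      rw [inner_smul_right, map_mul, inner_conj_symm, hv, Complex.conj_ofReal]
      push_cast
      rw [sub_sub_cancel, mul_assoc]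
    have hprod : Integrable (Function.uncurry fun t r : ℝ =>
        ((Real.exp (-a * t ^ 2) * Real.exp (-a * (t - r) ^ 2) : ℝ) : ℂ) * φ r)
        (volume.prod volume) := by
      have h3 : Integrable (fun z : ℝ × ℝ => (Real.exp (-a * z.1 ^ 2) : ℂ) * φ z.2)
          (volume.prod volume) := hw.ofReal.mul_prod hi
      have h4 : Continuous fun z : ℝ × ℝ => (Real.exp (-a * (z.1 - z.2) ^ 2) : ℂ) := by fun_prop
      refine (h3.mul_bdd (c := 1) h4.aestronglyMeasurable (.of_forall fun z => ?_)).congr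
        (.of_forall fun z => ?_)
      · rw [Complex.norm_real, Real.norm_eq_abs, Real.abs_exp, Real.exp_le_one_iff]
        nlinarith [mul_nonneg ha.le (sq_nonneg (z.1 - z.2))]
      · simp only [Function.uncurry]
        push_cast; ring
    rw [h2, integral_integral_swap hprod] at h1
    have h5 : ∀ r : ℝ, ∫ t : ℝ, ((Real.exp (-a * t ^ 2) * Real.exp (-a * (t - r) ^ 2) : ℝ) : ℂ)
        * φ r = (∫ t : ℝ, Real.exp (-(2 * a) * t ^ 2) : ℝ) *
          (φ r * (Real.exp (-(a / 2) * r ^ 2) : ℂ)) := by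
      intro r
      rw [integral_mul_const, integral_complex_ofReal, hW]
      push_cast; ring
    simp only [h5] at h1
    rw [integral_const_mul] at h1
    rw [Complex.nonneg_iff, Complex.re_ofReal_mul, Complex.im_ofReal_mul] at h1
    exact Complex.nonneg_iff.2 ⟨(mul_nonneg_iff_of_pos_left hC).1 h1.1,
      ((mul_eq_zero.1 h1.2.symm).resolve_left hC.ne').symm⟩
  have hlim : Filter.Tendsto (fun n : ℕ => ∫ r, φ r *
      (Real.exp (-((1 / ((n : ℝ) + 1)) / 2) * r ^ 2) : ℂ)) Filter.atTop (nhds (∫ r, φ r)) := by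
    refine tendsto_integral_of_dominated_convergence (fun r => ‖φ r‖) (fun n => ?_) hi.norm
      (fun n => .of_forall fun r => ?_) (.of_forall fun r => ?_)
    · exact (hφ.mul (by fun_prop)).aestronglyMeasurable
    · rw [norm_mul, Complex.norm_real, Real.norm_eq_abs, Real.abs_exp]
      refine mul_le_of_le_one_right (norm_nonneg _) (Real.exp_le_one_iff.2 ?_)
      have : 0 ≤ 1 / ((n : ℝ) + 1) := by positivity
      nlinarith [mul_nonneg this (sq_nonneg r)]
    · have h0 := tendsto_one_div_add_atTop_nhds_zero_nat (𝕜 := ℝ)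
      have hc : Continuous fun x : ℝ => φ r * (Real.exp (-(x / 2) * r ^ 2) : ℂ) := by fun_prop
      have h1 := (hc.tendsto 0).comp h0
      have h2 : φ r * (Real.exp (-((0 : ℝ) / 2) * r ^ 2) : ℂ) = φ r := by simp
      rw [h2] at h1
      exact h1
  exact ge_of_tendsto' hlim fun n => key _ (by positivity)

end PositiveType

section OneParticle

/-- The one-particle space `L²(ℝᵈ)`. -/
abbrev OneParticle (d : ℕ) : Type :=
  Lp ℂ 2 (volume : Measure (EuclideanSpace ℝ (Fin d)))

variable {d : ℕ}

/-- `m(H₁)`: multiplication by `m ∘ ω` (for essentially bounded `m ∘ ω`). -/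
def funH (ω : EuclideanSpace ℝ (Fin d) → ℝ) (m : ℝ → ℂ) : OneParticle d →L[ℂ] OneParticle d :=
  open Classical in
  if h : MemLp (fun k => m (ω k)) ⊤ (volume : Measure (EuclideanSpace ℝ (Fin d))) then
    (ContinuousLinearMap.mul ℂ ℂ).holderL volume ⊤ 2 2 (h.toLp _)
  else 0

variable {ω : EuclideanSpace ℝ (Fin d) → ℝ}

lemma funH_ae {m : ℝ → ℂ}
    (h : MemLp (fun k => m (ω k)) ⊤ (volume : Measure (EuclideanSpace ℝ (Fin d))))
    (f : OneParticle d) : funH ω m f =ᵐ[volume] fun k => m (ω k) * f k := by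
  rw [funH, dif_pos h]
  filter_upwards [(ContinuousLinearMap.mul ℂ ℂ).coeFn_holder (r := 2) (h.toLp _) f,
    h.coeFn_toLp] with k hk hk'
  rw [ContinuousLinearMap.holderL_apply_apply, hk, hk']
  rfl

lemma inner_funH {m : ℝ → ℂ}
    (h : MemLp (fun k => m (ω k)) ⊤ (volume : Measure (EuclideanSpace ℝ (Fin d))))
    (f f' : OneParticle d) :
    ⟪f, funH ω m f'⟫_ℂ = ∫ k, m (ω k) * (conj (f k) * f' k) := by
  rw [MeasureTheory.L2.inner_def]
  refine integral_congr_ae ?_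
  filter_upwards [funH_ae h f'] with k hk
  rw [hk, RCLike.inner_apply]; ring

lemma memLp_top (hω : Measurable ω) {m : ℝ → ℂ} (hm : Measurable m) {C : ℝ}
    (hC : ∀ k, ‖m (ω k)‖ ≤ C) :
    MemLp (fun k => m (ω k)) ⊤ (volume : Measure (EuclideanSpace ℝ (Fin d))) :=
  memLp_top_of_bound (hm.comp hω).aestronglyMeasurable C (.of_forall hC)

lemma funH_mul {m m' : ℝ → ℂ}
    (h : MemLp (fun k => m (ω k)) ⊤ (volume : Measure (EuclideanSpace ℝ (Fin d))))
    (h' : MemLp (fun k => m' (ω k)) ⊤ (volume : Measure (EuclideanSpace ℝ (Fin d)))) :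
    funH ω m * funH ω m' = funH ω (fun x => m x * m' x) := by
  ext1 f
  refine Lp.ext ?_
  have h'' : MemLp (fun k => m (ω k) * m' (ω k)) ⊤
      (volume : Measure (EuclideanSpace ℝ (Fin d))) := h'.mul h
  filter_upwards [funH_ae h (funH ω m' f), funH_ae h' f, funH_ae (m := fun x => m x * m' x) h'' f]
    with k h1 h2 h3
  rw [h3, ContinuousLinearMap.mul_def, ContinuousLinearMap.comp_apply, h1, h2]; ring

lemma star_funH {m : ℝ → ℂ}
    (h : MemLp (fun k => m (ω k)) ⊤ (volume : Measure (EuclideanSpace ℝ (Fin d)))) :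
    star (funH ω m) = funH ω (fun x => conj (m x)) := by
  rw [ContinuousLinearMap.star_eq_adjoint]
  symm
  rw [ContinuousLinearMap.eq_adjoint_iff]
  intro f f'
  have h'' : MemLp (fun k => conj (m (ω k))) ⊤
      (volume : Measure (EuclideanSpace ℝ (Fin d))) := h.star
  rw [inner_funH h, MeasureTheory.L2.inner_def]
  refine integral_congr_ae ?_
  filter_upwards [funH_ae (m := fun x => conj (m x)) h'' f] with k hk
  rw [hk, RCLike.inner_apply]; simp; ring

/-- The data of the reservoir and of its coupling, with the standing conditions on them. -/
structure Reservoir (d : ℕ) where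
  /-- the one-particle energy: `H₁` is multiplication by `ω` -/
  ω : EuclideanSpace ℝ (Fin d) → ℝ
  measurable_ω : Measurable ω
  bddBelow_ω : BddBelow (Set.range ω)
  /-- the inverse temperature -/
  β : ℝ
  β_pos : 0 < β
  /-- the frequency of the rotating wave condition -/
  ω₀ : ℝ
  /-- a projection that commutes with `H₁`, that is, with all bounded Borel functions of `H₁` -/
  P₀ : OneParticle d →L[ℂ] OneParticle d
  isStarProjection_P₀ : IsStarProjection P₀
  commute_P₀ : ∀ m : ℝ → ℂ, Measurable m → Commute P₀ (funH ω m)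
  /-- the two form factors -/
  g : Fin 2 → OneParticle d
  P₀_g_zero : P₀ (g 0) = g 0
  P₀_g_one : P₀ (g 1) = 0

namespace Reservoir
variable (R : Reservoir d)

/-- The free one-particle evolution `exp(i t H₁)`. -/
def S₀ (t : ℝ) : OneParticle d →L[ℂ] OneParticle d := funH R.ω fun x => cexp (I * (t * x))

/-- `S_t = exp(i t H₁) exp(-i t ω₀ P₀)`. -/
def S (t : ℝ) : OneParticle d →L[ℂ] OneParticle d :=
  R.S₀ t * NormedSpace.exp ((-(I * (t * R.ω₀)) : ℂ) • R.P₀)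

/-- `L = exp(-β H₁ / 2)`. -/
def L : OneParticle d →L[ℂ] OneParticle d := funH R.ω fun x => cexp (-(R.β * x / 2))

lemma memLp_S₀ (t : ℝ) : MemLp (fun k => cexp (I * (t * (R.ω k : ℂ)))) ⊤
    (volume : Measure (EuclideanSpace ℝ (Fin d))) := by
  refine memLp_top (m := fun x : ℝ => cexp (I * (t * x))) R.measurable_ω (by fun_prop) (C := 1) ?_
  intro k
  rw [mul_comm, ← Complex.ofReal_mul, Complex.norm_exp_ofReal_mul_I]

lemma memLp_L : MemLp (fun k => cexp (-(R.β * (R.ω k : ℂ) / 2))) ⊤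
    (volume : Measure (EuclideanSpace ℝ (Fin d))) := by
  obtain ⟨c, hc⟩ := R.bddBelow_ω
  refine memLp_top (m := fun x : ℝ => cexp (-(R.β * x / 2))) R.measurable_ω (by fun_prop)
    (C := Real.exp (-(R.β * c / 2))) ?_
  intro k
  have h1 : c ≤ R.ω k := hc ⟨k, rfl⟩
  have h2 := R.β_pos
  rw [Complex.norm_exp]
  have : (-((R.β : ℂ) * (R.ω k : ℂ) / 2)).re = -(R.β * R.ω k / 2) := by
    rw [Complex.neg_re, ← Complex.ofReal_mul]
    simp
  rw [this]
  gcongr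

lemma S₀_mul (s t : ℝ) : R.S₀ s * R.S₀ t = R.S₀ (s + t) := by
  refine (funH_mul (R.memLp_S₀ s) (R.memLp_S₀ t)).trans ?_
  unfold S₀
  congr 1
  ext x
  rw [← Complex.exp_add]
  push_cast; ring_nf

lemma star_S₀ (t : ℝ) : star (R.S₀ t) = R.S₀ (-t) := by
  refine (star_funH (R.memLp_S₀ t)).trans ?_
  unfold S₀
  congr 1
  ext x
  rw [← Complex.exp_conj]
  simp

lemma star_L : star R.L = R.L := by
  refine (star_funH R.memLp_L).trans ?_
  unfold L
  congr 1
  ext x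
  rw [← Complex.exp_conj]
  simp [show conj (2 : ℂ) = 2 from Complex.conj_ofNat 2]

lemma S₀_L (t : ℝ) : Commute (R.S₀ t) R.L := by
  refine (funH_mul (R.memLp_S₀ t) R.memLp_L).trans ((funH_mul R.memLp_L (R.memLp_S₀ t)).trans ?_).symm
  congr 1
  ext x
  ring

lemma S₀_zero : R.S₀ 0 = 1 := by
  ext1 f
  refine Lp.ext ?_
  filter_upwards [funH_ae (m := fun x : ℝ => cexp (I * ((0 : ℝ) * x))) (R.memLp_S₀ 0) f] with k hk
  refine hk.trans ?_
  simp

lemma commute_P₀_S₀ (t : ℝ) : Commute R.P₀ (R.S₀ t) := R.commute_P₀ _ (by fun_prop)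

lemma commute_P₀_L : Commute R.P₀ R.L := R.commute_P₀ _ (by fun_prop)

lemma S_mul (s t : ℝ) : R.S s * R.S t = R.S (s + t) := by
  have h1 : Commute (NormedSpace.exp ((-(I * (s * R.ω₀)) : ℂ) • R.P₀)) (R.S₀ t) :=
    ((R.commute_P₀_S₀ t).smul_left _).exp_left
  have h2 : Commute ((-(I * (s * R.ω₀)) : ℂ) • R.P₀) ((-(I * (t * R.ω₀)) : ℂ) • R.P₀) :=
    ((Commute.refl R.P₀).smul_left _).smul_right _
  let +nondep : NormedAlgebra ℚ (OneParticle d →L[ℂ] OneParticle d) := .restrictScalars ℚ ℂ _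
  unfold S
  rw [mul_assoc, ← mul_assoc _ (R.S₀ t), h1.eq, mul_assoc, ← mul_assoc, S₀_mul,
    ← NormedSpace.exp_add_of_commute h2, ← add_smul]
  push_cast; ring_nf

lemma S_zero : R.S 0 = 1 := by
  simp [S, S₀_zero]

lemma star_S (t : ℝ) : star (R.S t) = R.S (-t) := by
  have h1 : Commute (NormedSpace.exp ((-(I * ((-t : ℝ) * R.ω₀)) : ℂ) • R.P₀)) (R.S₀ (-t)) :=
    ((R.commute_P₀_S₀ _).smul_left _).exp_left
  unfold S
  rw [star_mul, star_S₀, NormedSpace.star_exp, star_smul, R.isStarProjection_P₀.isSelfAdjoint.star_eq]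
  rw [← h1.eq]
  congr 3
  simp

lemma commute_S_L (t : ℝ) : Commute (R.S t) R.L :=
  (R.S₀_L t).mul_left ((R.commute_P₀_L.smul_left _).exp_left)

lemma inner_S_S (s t : ℝ) (x y : OneParticle d) :
    ⟪R.S s x, R.S t y⟫_ℂ = ⟪x, R.S (t - s) y⟫_ℂ := by
  rw [← ContinuousLinearMap.adjoint_inner_right, ← ContinuousLinearMap.star_eq_adjoint, star_S,
    ← ContinuousLinearMap.comp_apply, ← ContinuousLinearMap.mul_def, S_mul]
  congr 3; ring

lemma continuous_inner_S₀ (x y : OneParticle d) : Continuous fun t => ⟪x, R.S₀ t y⟫_ℂ := by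
  have h : ∀ t, ⟪x, R.S₀ t y⟫_ℂ = ∫ k, cexp (I * (t * R.ω k)) * (conj (x k) * y k) :=
    fun t => inner_funH (m := fun z : ℝ => cexp (I * (t * z))) (R.memLp_S₀ t) x y
  simp only [h]
  have hi : Integrable (fun k => conj (x k) * y k) := by
    have := MeasureTheory.L2.integrable_inner (𝕜 := ℂ) x y
    refine this.congr (.of_forall fun k => ?_)
    simp [RCLike.inner_apply, mul_comm]
  have hm := R.measurable_ω
  refine continuous_of_dominated (bound := fun k => ‖conj (x k) * y k‖) ?_ ?_ hi.norm ?_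
  · intro t
    refine AEStronglyMeasurable.mul ?_ hi.1
    exact (by fun_prop : Measurable fun k => cexp (I * (t * (R.ω k : ℂ)))).aestronglyMeasurable
  · intro t
    refine .of_forall fun k => ?_
    rw [norm_mul, mul_comm I, ← Complex.ofReal_mul, Complex.norm_exp_ofReal_mul_I, one_mul]
  · refine .of_forall fun k => ?_
    fun_prop

lemma continuous_S₀ (y : OneParticle d) : Continuous fun t => R.S₀ t y := by
  refine continuous_of_inner_eq (φ := fun t => ⟪y, R.S₀ t y⟫_ℂ) (fun s t => ?_)
    (R.continuous_inner_S₀ y y)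
  rw [← ContinuousLinearMap.adjoint_inner_right, ← ContinuousLinearMap.star_eq_adjoint, star_S₀,
    ← ContinuousLinearMap.comp_apply, ← ContinuousLinearMap.mul_def, S₀_mul, neg_add_eq_sub]

lemma continuous_inner_S (x y : OneParticle d) : Continuous fun t => ⟪x, R.S t y⟫_ℂ := by
  let +nondep : NormedAlgebra ℚ (OneParticle d →L[ℂ] OneParticle d) := .restrictScalars ℚ ℂ _
  have h : ∀ t, ⟪x, R.S t y⟫_ℂ
      = ⟪R.S₀ (-t) x, NormedSpace.exp ((-(I * (t * R.ω₀)) : ℂ) • R.P₀) y⟫_ℂ := by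
    intro t
    rw [← star_S₀, ContinuousLinearMap.star_eq_adjoint, ContinuousLinearMap.adjoint_inner_left]
    rfl
  simp only [h]
  have h1 : Continuous fun t : ℝ => R.S₀ (-t) x := (R.continuous_S₀ x).comp continuous_neg
  have h2 : Continuous fun t : ℝ => NormedSpace.exp ((-(I * (t * R.ω₀)) : ℂ) • R.P₀) :=
    NormedSpace.exp_continuous.comp (by fun_prop)
  exact h1.inner (h2.clm_apply continuous_const)

/-- `(f₀ ⊗ f₁ | f₀' ⊗ f₁') = ∫ ⟨f₀, S_t f₀'⟩ conj ⟨f₁, S_t L² f₁'⟩ dt`. -/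
def betaForm (K : Submodule ℂ (OneParticle d)) : Matrix (K × K) (K × K) ℂ :=
  Matrix.of fun a b => ∫ t : ℝ, ⟪(a.1 : OneParticle d), R.S t b.1⟫_ℂ *
    conj ⟪(a.2 : OneParticle d), R.S t (R.L (R.L b.2))⟫_ℂ

lemma inner_S_L_L (t : ℝ) (x y : OneParticle d) :
    ⟪x, R.S t (R.L (R.L y))⟫_ℂ = ⟪R.L x, R.S t (R.L y)⟫_ℂ := by
  have h := congrArg (fun A => A (R.L y)) (R.commute_S_L t).eq
  simp only [ContinuousLinearMap.mul_def, ContinuousLinearMap.comp_apply] at h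
  rw [h, ← ContinuousLinearMap.adjoint_inner_left, ← ContinuousLinearMap.star_eq_adjoint, star_L]

lemma norm_inner_S_le (t : ℝ) (x y : OneParticle d) : ‖⟪x, R.S t y⟫_ℂ‖ ≤ ‖x‖ * ‖y‖ := by
  have h : ‖R.S t y‖ = ‖y‖ := by
    have := R.inner_S_S t t y y
    rw [sub_self, S_zero, one_apply_eq_self, inner_self_eq_norm_sq_to_K,
      inner_self_eq_norm_sq_to_K] at this
    have h2 : ‖R.S t y‖ ^ 2 = ‖y‖ ^ 2 := by exact_mod_cast this
    exact (sq_eq_sq₀ (norm_nonneg _) (norm_nonneg _)).1 h2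
  exact (norm_inner_le_norm _ _).trans_eq (by rw [h])

lemma betaForm_posSemidef (K : Submodule ℂ (OneParticle d))
    (hK : ∀ f ∈ K, ∀ f' ∈ K, Integrable fun t : ℝ => ⟪f, R.S t f'⟫_ℂ) :
    (R.betaForm K).PosSemidef := by
  have hint : ∀ a b : K × K, Integrable fun t : ℝ => ⟪(a.1 : OneParticle d), R.S t b.1⟫_ℂ *
      conj ⟪(a.2 : OneParticle d), R.S t (R.L (R.L b.2))⟫_ℂ := by
    intro a b
    refine (hK _ a.1.2 _ b.1.2).mul_bdd (c := ‖(a.2 : OneParticle d)‖ * ‖R.L (R.L b.2)‖) ?_ ?_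
    · exact (Complex.continuous_conj.comp (R.continuous_inner_S _ _)).aestronglyMeasurable
    · refine .of_forall fun t => ?_
      rw [RCLike.norm_conj]
      exact R.norm_inner_S_le _ _ _
  refine ⟨?_, fun c => ?_⟩
  · ext a b
    simp only [betaForm, Matrix.conjTranspose_apply, Matrix.of_apply, RCLike.star_def]
    rw [← integral_conj, ← integral_neg_eq_self]
    congr 1
    ext t
    have h1 : ∀ x y : OneParticle d, conj ⟪x, R.S (-t) y⟫_ℂ = ⟪y, R.S t x⟫_ℂ := by
      intro x y
      rw [inner_conj_symm, ← R.star_S, ContinuousLinearMap.star_eq_adjoint,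
        ContinuousLinearMap.adjoint_inner_left]
    rw [map_mul, h1, inner_S_L_L, h1, inner_S_L_L]
  · -- the vectors `(s, a) ↦ S_s a₀ ⊗ conj (S_s L a₁)`, through their Gram kernel
    let k : Matrix (ℝ × K × K) (ℝ × K × K) ℂ :=
      Matrix.hadamard (Matrix.of fun p q => ⟪R.S p.1 p.2.1, R.S q.1 q.2.1⟫_ℂ)
        (Matrix.transpose (Matrix.of fun p q =>
          ⟪R.S p.1 (R.L p.2.2), R.S q.1 (R.L q.2.2)⟫_ℂ))
    have hk : k.PosSemidef := (gram_posSemidef fun p : ℝ × K × K => R.S p.1 p.2.1).hadamard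
      (gram_posSemidef fun p : ℝ × K × K => R.S p.1 (R.L p.2.2)).transpose
    let v : ℝ → KernelSpace k hk := fun s => c.sum fun a z => z • KernelSpace.vec k hk (s, a)
    let φ : ℝ → ℂ := fun t => c.sum fun a z => c.sum fun b w => conj z *
      (⟪(a.1 : OneParticle d), R.S t b.1⟫_ℂ *
        conj ⟪(a.2 : OneParticle d), R.S t (R.L (R.L b.2))⟫_ℂ) * w
    have hv : ∀ s t, ⟪v s, v t⟫_ℂ = φ (t - s) := by
      intro s t
      simp only [v, φ]
      rw [Finsupp.sum_inner]
      refine Finsupp.sum_congr fun a _ => ?_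
      rw [Finsupp.inner_sum]
      refine Finsupp.sum_congr fun b _ => ?_
      rw [inner_smul_left, inner_smul_right, KernelSpace.inner_vec]
      simp only [k, Matrix.hadamard_apply, Matrix.transpose_apply, Matrix.of_apply]
      rw [inner_S_S, inner_S_L_L, ← inner_S_S, ← inner_S_S (x := R.L a.2), inner_conj_symm]
      ring
    have hφc : Continuous φ := by
      refine continuous_finsetSum _ fun a _ => continuous_finsetSum _ fun b _ => ?_
      refine ((Continuous.mul (R.continuous_inner_S _ _) ?_).const_mul _).mul_const _
      exact Complex.continuous_conj.comp (R.continuous_inner_S _ _)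
    have hφi : Integrable φ := by
      refine integrable_finsetSum _ fun a _ => integrable_finsetSum _ fun b _ => ?_
      exact ((hint a b).const_mul _).mul_const _
    have := integral_nonneg_of_inner_eq hv hφc hφi
    refine this.trans_eq ?_
    simp only [φ, Finsupp.sum]
    rw [integral_finsetSum _ fun a _ => integrable_finsetSum _ fun b _ =>
      ((hint a b).const_mul _).mul_const _]
    refine Finset.sum_congr rfl fun a _ => ?_
    rw [integral_finsetSum _ fun b _ => ((hint a b).const_mul _).mul_const _]
    refine Finset.sum_congr rfl fun b _ => ?_
    rw [integral_mul_const, integral_const_mul]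
    rfl

/-- `γ_ε(E) = ∫_{-∞}^0 ⟨g_ε, S_t g_ε⟩ exp(-i t E) dt`. -/
def γ (ε : Fin 2) (E : ℝ) : ℂ :=
  ∫ t in Set.Iic (0 : ℝ), ⟪R.g ε, R.S t (R.g ε)⟫_ℂ * cexp (-(I * (t * E)))

/-- The matrix element `⟨f, P_E f'⟩` of `P_E = (2π)⁻¹ ∫ S_t exp(-i t E) dt = δ(H₁' - E)`. -/
def innerP (f f' : OneParticle d) (E : ℝ) : ℂ :=
  (1 / (2 * Real.pi) : ℝ) * ∫ t : ℝ, ⟪f, R.S t f'⟫_ℂ * cexp (-(I * (t * E)))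

end Reservoir
end OneParticle

section Fock

/-- The exponential kernel `(f, f') ↦ exp ⟨f, f'⟩` of a Hilbert space. -/
def expKernel (V : Type) [NormedAddCommGroup V] [InnerProductSpace ℂ V] : Matrix V V ℂ :=
  Matrix.of fun f f' => cexp ⟪f, f'⟫_ℂ

lemma expKernel_posSemidef (V : Type) [NormedAddCommGroup V] [InnerProductSpace ℂ V] :
    (expKernel V).PosSemidef :=
  exp_posSemidef (gram_posSemidef fun f : V => f)

/-- The Boson Fock space over `V`, as the Hilbert space that is spanned by the exponential vectors
`ψ(f)`, where `⟨ψ(f), ψ(f')⟩ = exp ⟨f, f'⟩`. -/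
abbrev FockSpace (V : Type) [NormedAddCommGroup V] [InnerProductSpace ℂ V] : Type :=
  KernelSpace (expKernel V) (expKernel_posSemidef V)

/-- The exponential vector `ψ(f)`. -/
def expVec {V : Type} [NormedAddCommGroup V] [InnerProductSpace ℂ V] (f : V) : FockSpace V :=
  KernelSpace.vec (expKernel V) (expKernel_posSemidef V) f

/-- The vacuum vector. -/
def vacuum (V : Type) [NormedAddCommGroup V] [InnerProductSpace ℂ V] : FockSpace V := expVec 0

end Fock

/-- The model: a reservoir, a system operator `D`, and a space `K` of one-particle vectors. -/
structure LowDensityModel (d : ℕ) (HS : Type*) [NormedAddCommGroup HS] [InnerProductSpace ℂ HS]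
    [CompleteSpace HS] extends Reservoir d where
  /-- the operator of the system in the interaction -/
  D : HS →L[ℂ] HS
  K : Submodule ℂ (OneParticle d)
  g_mem_K : ∀ ε, g ε ∈ K
  K_le : K ≤ (Submodule.span ℂ {f | ∃ t ε, f = toReservoir.S t (g ε)}).topologicalClosure
  integrable_K : ∀ f ∈ K, ∀ f' ∈ K, Integrable fun t : ℝ => ⟪f, toReservoir.S t f'⟫_ℂ
  /-- the inverse operators `T_ε(E)` exist -/
  isUnit_T : ∀ (ε : Fin 2) (E : ℝ), IsUnit (1 + (toReservoir.γ ε E * toReservoir.γ (1 - ε) E) •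
    ((![D, star D] ε) * (![D, star D] (1 - ε))))

namespace LowDensityModel
variable {d : ℕ} {HS : Type*} [NormedAddCommGroup HS] [InnerProductSpace ℂ HS] [CompleteSpace HS]
variable (M : LowDensityModel d HS)

/-- `D_0 = D` and `D_1 = D⁺`. -/
def Dop (ε : Fin 2) : HS →L[ℂ] HS := ![M.D, star M.D] ε

/-- `T_ε(E) = (1 + γ_ε(E) γ_{1-ε}(E) D_ε D_{1-ε})⁻¹`. -/
def T (ε : Fin 2) (E : ℝ) : HS →L[ℂ] HS :=
  Ring.inverse (1 + (M.γ ε E * M.γ (1 - ε) E) • (M.Dop ε * M.Dop (1 - ε)))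

/-- The drift density `γ_{1-ε}(E) D_ε D_{1-ε} T_ε(E) ⟨g_ε, P_E L² g_ε⟩`. -/
def drift (ε : Fin 2) (E : ℝ) : HS →L[ℂ] HS :=
  (M.γ (1 - ε) E * M.innerP (M.g ε) (M.L (M.L (M.g ε))) E) •
    (M.Dop ε * M.Dop (1 - ε) * M.T ε E)

/-- `Γ = ∑_ε ∫ γ_{1-ε}(E) D_ε D_{1-ε} T_ε(E) ⟨g_ε, P_E L² g_ε⟩ dE`. -/
def Γ : HS →L[ℂ] HS := ∑ ε : Fin 2, ∫ E : ℝ, M.drift ε E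

/-! ### The master space -/

/-- `K ⊗_β K`: the completion of `K ⊗ K*` for the form
`(f₀ ⊗ f₁ | f₀' ⊗ f₁') = ∫ ⟨f₀, S_t f₀'⟩ conj ⟨f₁, S_t L² f₁'⟩ dt`. -/
abbrev PairSpace : Type :=
  KernelSpace (M.betaForm M.K) (M.betaForm_posSemidef M.K M.integrable_K)

/-- `f₀ ⊗_β f₁`. -/
def tens (f₀ f₁ : M.K) : M.PairSpace :=
  KernelSpace.vec (M.betaForm M.K) (M.betaForm_posSemidef M.K M.integrable_K) (f₀, f₁)

/-- The master space `F(L²(ℝ) ⊗ K ⊗_β K)`, with `L²(ℝ) ⊗ K ⊗_β K = L²(ℝ; K ⊗_β K)`. -/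
abbrev MasterSpace : Type := FockSpace (Lp M.PairSpace 2 (volume : Measure ℝ))

/-- The Hilbert space tensor product of the system space and the master space. -/
abbrev TotalSpace : Type _ := UniformSpace.Completion (HS ⊗[ℂ] M.MasterSpace)

/-- `u ⊗ x`. -/
def tmul (u : HS) (x : M.MasterSpace) : M.TotalSpace :=
  ((u ⊗ₜ[ℂ] x : HS ⊗[ℂ] M.MasterSpace) : M.TotalSpace)

/-- `X ⊗ 1`. -/
def ampl (X : HS →L[ℂ] HS) : M.TotalSpace →L[ℂ] M.TotalSpace :=
  (TensorProduct.mapL X (ContinuousLinearMap.id ℂ M.MasterSpace)).completion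

/-- The isometry `u ↦ u ⊗ Ω`, with the vacuum `Ω`. -/
def vacuumEmbedding : HS →L[ℂ] M.TotalSpace :=
  UniformSpace.Completion.toComplL ∘L
    (TensorProduct.mkL ℂ HS M.MasterSpace).flip (vacuum _)

/-- The vacuum expectation of `U`: the operator `V` on the system space such that
`⟨u, V v⟩ = ⟨u ⊗ Ω, U (v ⊗ Ω)⟩`. -/
def vacuumExpectation (U : M.TotalSpace →L[ℂ] M.TotalSpace) : HS →L[ℂ] HS :=
  ContinuousLinearMap.adjoint M.vacuumEmbedding ∘L U ∘L M.vacuumEmbedding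

lemma inner_vacuumExpectation (U : M.TotalSpace →L[ℂ] M.TotalSpace) (u v : HS) :
    ⟪u, M.vacuumExpectation U v⟫_ℂ = ⟪M.tmul u (vacuum _), U (M.tmul v (vacuum _))⟫_ℂ := by
  simp only [vacuumExpectation, ContinuousLinearMap.comp_apply,
    ContinuousLinearMap.adjoint_inner_right]
  rfl

/-! ### The normally ordered equation -/

/-- A test function `∑ φ ⊗ (f₀ ⊗_β f₁)` on the time axis, with continuous compactly supported `φ`
and with `f₀, f₁` in `K`, as the list of its terms. -/
abbrev TestFun : Type := List (C_c(ℝ, ℂ) × M.K × M.K)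

lemma memLp_test (φ : C_c(ℝ, ℂ)) (f₀ f₁ : M.K) :
    MemLp (fun t => φ t • M.tens f₀ f₁) 2 (volume : Measure ℝ) :=
  Continuous.memLp_of_hasCompactSupport (φ.continuous.smul continuous_const)
    φ.hasCompactSupport.smul_right

/-- The element of `L²(ℝ; K ⊗_β K)` of a test function. -/
def testLp (f : M.TestFun) : Lp M.PairSpace 2 (volume : Measure ℝ) :=
  (f.map fun x => (M.memLp_test x.1 x.2.1 x.2.2).toLp _).sum

/-- `⟨f(t) | g_ε ⊗_β P_E g_ε'⟩`. On `f(t) = f₀ ⊗_β f₁`, it is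
`∫ ⟨f₀, S_s g_ε⟩ conj ⟨f₁, S_s L² P_E g_ε'⟩ ds = 2π ⟨f₀, P_E g_ε⟩ conj ⟨f₁, P_E L² g_ε'⟩`, as
`S_s P_E = exp(i s E) P_E`. -/
def bra (f : M.TestFun) (t : ℝ) (ε ε' : Fin 2) (E : ℝ) : ℂ :=
  (f.map fun x => conj (x.1 t) * ((2 * Real.pi : ℝ) * M.innerP x.2.1 (M.g ε) E *
    conj (M.innerP x.2.2 (M.L (M.L (M.g ε'))) E))).sum

/-- `⟨g_ε ⊗_β P_E g_ε' | f(t)⟩`. This is the factor by which the annihilation operator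
`B_{ε,ε'}(E,t) = b_t(g_ε ⊗_β P_E g_ε')` multiplies the exponential vector `ψ(f)`. -/
def ket (f : M.TestFun) (t : ℝ) (ε ε' : Fin 2) (E : ℝ) : ℂ := conj (M.bra f t ε ε' E)

/-- `n_ε(E) = 1 / ⟨g_ε, P_E L² g_ε⟩`. -/
def n (ε : Fin 2) (E : ℝ) : ℂ := 1 / M.innerP (M.g ε) (M.L (M.L (M.g ε))) E

/-- `⟨u ⊗ ψ(f), (X ⊗ 1) U (v ⊗ ψ(f'))⟩`. -/
def matEl (U : M.TotalSpace →L[ℂ] M.TotalSpace) (u v : HS) (f f' : M.TestFun)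
    (X : HS →L[ℂ] HS) : ℂ :=
  ⟪M.tmul u (expVec (M.testLp f)), M.ampl X (U (M.tmul v (expVec (M.testLp f'))))⟫_ℂ

/-- The matrix element, between `u ⊗ ψ(f)` and `v ⊗ ψ(f')`, of the right-hand side of the normally
ordered equation at time `t`. The creation operators stand on the left of `U_t` and the annihilation
operators on its right; they act on the exponential vectors by the factors `bra` and `ket`. -/
def normalRHS (U : M.TotalSpace →L[ℂ] M.TotalSpace) (u v : HS) (f f' : M.TestFun) (t : ℝ) : ℂ :=
  -∑ ε : Fin 2, ∫ E : ℝ,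
    (M.matEl U u v f f' (I • (M.T ε E * M.Dop ε)) *
        ∑ ε' : Fin 2, M.n ε' E * M.bra f t ε ε' E * M.ket f' t (1 - ε) ε' E
      + M.matEl U u v f f' (M.γ (1 - ε) E • (M.Dop ε * M.Dop (1 - ε) * M.T ε E)) *
        ∑ ε' : Fin 2, M.n ε' E * M.bra f t ε ε' E * M.ket f' t ε ε' E
      + M.matEl U u v f f' (I • (M.T ε E * M.Dop ε)) * M.bra f t ε (1 - ε) E
      + M.matEl U u v f f' (M.γ (1 - ε) E • (M.Dop ε * M.Dop (1 - ε) * M.T ε E)) * M.bra f t ε ε E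
      + M.matEl U u v f f' (I • (M.T ε E * M.Dop ε)) * M.ket f' t (1 - ε) ε E
      + M.matEl U u v f f' (M.γ (1 - ε) E • (M.Dop ε * M.Dop (1 - ε) * M.T ε E)) * M.ket f' t ε ε E
      + M.matEl U u v f f' (M.γ (1 - ε) E • (M.Dop ε * M.Dop (1 - ε) * M.T ε E)) *
        M.innerP (M.g ε) (M.L (M.L (M.g ε))) E)

/-- `U` solves the normally ordered equation with `U_0 = 1` for `t ≥ 0`, in integrated form between
exponential vectors. -/
def IsEvolution (U : ℝ → M.TotalSpace →L[ℂ] M.TotalSpace) : Prop :=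
  ∀ (u v : HS) (f f' : M.TestFun) (t : ℝ), 0 ≤ t →
    IntervalIntegrable (fun s => M.normalRHS (U s) u v f f' s) volume 0 t ∧
    ⟪M.tmul u (expVec (M.testLp f)), U t (M.tmul v (expVec (M.testLp f')))⟫_ℂ =
      ⟪M.tmul u (expVec (M.testLp f)), M.tmul v (expVec (M.testLp f'))⟫_ℂ +
        ∫ s in (0 : ℝ)..t, M.normalRHS (U s) u v f f' s

end LowDensityModel
end LowDensity

end

/-! The vacuum is the exponential vector of the zero test function, so between vacuum vectors every
term of the equation that contains a creation or annihilation factor vanishes and only the drift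
survives (`normalRHS_vacuum`). The vacuum expectation is therefore a weak solution of V_t = 1 - ∫₀ᵗ
Γ V_s ds, and for bounded Γ such a solution is unique: `eq_exp_of_weak_integral_eq`. What remains is
analysis of Γ.

Convergence. Since ω ≥ c, the operator L² is exp(-βc) exp(-β|H₁ - c|), which is an average of
exp(isH₁) with a Cauchy weight. On g_ε the evolutions S₀ and S differ by a phase only, so ⟨g_ε, P_E
L² g_ε⟩ is the Fourier transform of ⟨g_ε, S_t g_ε⟩ times a factor that decays exponentially in |E|
(`innerP_L_L`). The other factors of the drift are bounded, since γ → 0 and T → 1 at infinity by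
Riemann–Lebesgue.

Damping. The correlation functions are of positive type, so their Fourier transforms are
non-negative and Re γ_ε ≥ 0. With w = T_ε(E)u, the identity `re_inner_resolvent` writes the real
part of the drift form as Re γ_{1-ε} ‖D_{1-ε}w‖² + Re γ_ε |γ_{1-ε}|² ‖D_ε D_{1-ε}w‖², times the
non-negative thermal density.

Exponential decay. The spectral densities of g_0 and g_1 may have disjoint supports, so the first
summand may give nothing. The second is enough: the density of g_ε is positive on some interval, and
γ_{1-ε} cannot vanish on a whole interval (`exists_halfFourierInt_ne_zero`). If it did, its real
part would leave a spectral gap there; inside the gap γ_{1-ε} is, up to a constant, a Stieltjes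
transform of a non-negative density, hence strictly monotone unless the density is zero. This makes
Γ coercive (`Γ_coercive`), and a coercive generator gives an exponentially decaying semigroup. -/

noncomputable section
namespace LowDensity
open MeasureTheory Complex Matrix Filter Topology
open scoped ComplexConjugate InnerProductSpace ComplexOrder TensorProduct CompactlySupported


/-! ### Fourier transforms of functions of positive type, on the line and on the half-line. -/

section FourierPositive

/-- The Fourier integral `∫ φ(t) exp(-i t E) dt`. -/
def fourierInt (φ : ℝ → ℂ) (E : ℝ) : ℂ := ∫ t : ℝ, φ t * cexp (-(I * (t * E)))

/-- The Fourier integral over the negative half-line. -/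
def halfFourierInt (φ : ℝ → ℂ) (E : ℝ) : ℂ :=
  ∫ t in Set.Iic (0 : ℝ), φ t * cexp (-(I * (t * E)))

lemma norm_cexp_neg_I_mul (t E : ℝ) : ‖cexp (-(I * (t * E)))‖ = 1 := by
  rw [show -(I * ((t : ℂ) * E)) = ((-(t * E) : ℝ) : ℂ) * I by push_cast; ring,
    Complex.norm_exp_ofReal_mul_I]

lemma norm_cexp_I_mul (t E : ℝ) : ‖cexp (I * (t * E))‖ = 1 := by
  rw [show I * ((t : ℂ) * E) = ((t * E : ℝ) : ℂ) * I by push_cast; ring,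
    Complex.norm_exp_ofReal_mul_I]

variable {φ : ℝ → ℂ}

lemma integrable_mul_cexp {μ : Measure ℝ} (hi : Integrable φ μ) (E : ℝ) :
    Integrable (fun t : ℝ => φ t * cexp (-(I * (t * E)))) μ :=
  hi.mul_bdd (c := 1) (by fun_prop : Continuous fun t : ℝ => cexp (-(I * (t * E)))).aestronglyMeasurable
    (.of_forall fun t => (norm_cexp_neg_I_mul t E).le)

lemma continuous_integral_mul_cexp {μ : Measure ℝ} (hi : Integrable φ μ) :
    Continuous fun E : ℝ => ∫ t : ℝ, φ t * cexp (-(I * (t * E))) ∂μ := by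
  refine continuous_of_dominated (bound := fun t => ‖φ t‖)
    (fun E => (integrable_mul_cexp hi E).aestronglyMeasurable) (fun E => .of_forall fun t => ?_)
    hi.norm (.of_forall fun t => by fun_prop)
  rw [norm_mul, norm_cexp_neg_I_mul, mul_one]

lemma continuous_fourierInt (hi : Integrable φ) : Continuous (fourierInt φ) :=
  continuous_integral_mul_cexp hi

lemma continuous_halfFourierInt (hi : Integrable φ) : Continuous (halfFourierInt φ) :=
  continuous_integral_mul_cexp hi.integrableOn

lemma fourierInt_eq_fourier (φ : ℝ → ℂ) (w : ℝ) :
    FourierTransform.fourier φ w = fourierInt φ (2 * Real.pi * w) := by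
  rw [Real.fourier_real_eq_integral_exp_smul, fourierInt]
  congr 1
  ext t
  rw [smul_eq_mul, mul_comm]
  congr 2
  push_cast; ring

/-- Riemann–Lebesgue, rescaled by 2π. Integrability is not needed: for other φ the integral is zero
by convention at every E. -/
lemma tendsto_fourierInt_cocompact (φ : ℝ → ℂ) :
    Tendsto (fourierInt φ) (cocompact ℝ) (𝓝 0) := by
  have h := Real.zero_at_infty_fourier φ
  have h2 : Tendsto (fun E : ℝ => E * (2 * Real.pi)⁻¹) (cocompact ℝ) (cocompact ℝ) :=
    (Homeomorph.mulRight₀ (2 * Real.pi)⁻¹ (by positivity)).isClosedEmbedding.tendsto_cocompact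
  refine (h.comp h2).congr fun E => ?_
  rw [Function.comp_apply, fourierInt_eq_fourier]
  congr 1
  field_simp

lemma halfFourierInt_eq (φ : ℝ → ℂ) :
    halfFourierInt φ = fourierInt (Set.indicator (Set.Iic 0) φ) := by
  ext E
  rw [halfFourierInt, fourierInt, ← integral_indicator measurableSet_Iic]
  congr 1
  ext t
  by_cases h : t ∈ Set.Iic (0 : ℝ) <;> simp [h]

lemma tendsto_halfFourierInt_cocompact (φ : ℝ → ℂ) :
    Tendsto (halfFourierInt φ) (cocompact ℝ) (𝓝 0) := by
  rw [halfFourierInt_eq]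
  exact tendsto_fourierInt_cocompact _

variable {H : Type*} [NormedAddCommGroup H] [InnerProductSpace ℂ H] {v : ℝ → H}

/-- The easy half of Bochner's theorem: the modulated path exp(-itE) v(t) is again stationary, and
its correlation function is the integrand. -/
lemma fourierInt_nonneg [CompleteSpace H] (hv : ∀ s t, ⟪v s, v t⟫_ℂ = φ (t - s))
    (hφ : Continuous φ) (hi : Integrable φ) (E : ℝ) : 0 ≤ fourierInt φ E := by
  refine integral_nonneg_of_inner_eq (v := fun t => cexp (-(I * (t * E))) • v t)
    (φ := fun t : ℝ => φ t * cexp (-(I * (t * E)))) (fun s t => ?_) (by fun_prop)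
    (integrable_mul_cexp hi E)
  rw [inner_smul_left, inner_smul_right, hv, ← Complex.exp_conj, ← mul_assoc, ← Complex.exp_add,
    mul_comm]
  congr 2
  simp
  ring

lemma conj_positiveType (hv : ∀ s t, ⟪v s, v t⟫_ℂ = φ (t - s)) (t : ℝ) : conj (φ t) = φ (-t) := by
  have h1 := hv 0 t
  have h2 := hv t 0
  rw [sub_zero] at h1
  rw [zero_sub] at h2
  rw [← h1, ← h2, inner_conj_symm]

lemma norm_positiveType_le (hv : ∀ s t, ⟪v s, v t⟫_ℂ = φ (t - s)) (t : ℝ) :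
    ‖φ t‖ ≤ (φ 0).re := by
  have h1 : ∀ t, ‖v t‖ ^ 2 = (φ 0).re := by
    intro t
    have := hv t t
    rw [sub_self] at this
    rw [← this, ← inner_self_eq_norm_sq (𝕜 := ℂ)]
    rfl
  have h2 := hv 0 t
  rw [sub_zero] at h2
  rw [← h2]
  refine (norm_inner_le_norm _ _).trans ?_
  have h3 : ‖v t‖ = ‖v 0‖ :=
    (sq_eq_sq₀ (norm_nonneg _) (norm_nonneg _)).1 ((h1 t).trans (h1 0).symm)
  rw [h3, ← sq, h1]

/-- As φ(-t) is the conjugate of φ(t), the integral over the positive half-line is the conjugate of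
the one over the negative half-line. -/
lemma two_mul_re_halfFourierInt (hv : ∀ s t, ⟪v s, v t⟫_ℂ = φ (t - s)) (hi : Integrable φ)
    (E : ℝ) : 2 * (halfFourierInt φ E).re = (fourierInt φ E).re := by
  have h1 : conj (halfFourierInt φ E)
      = ∫ t in Set.Ioi (0 : ℝ), φ t * cexp (-(I * (t * E))) := by
    rw [halfFourierInt, ← integral_conj]
    have := integral_comp_neg_Iic (0 : ℝ) fun t : ℝ => φ t * cexp (-(I * (t * E)))
    rw [neg_zero] at this
    rw [← this]
    congr 1
    ext t
    rw [map_mul, conj_positiveType hv, ← Complex.exp_conj]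
    congr 2
    simp
  have h2 : fourierInt φ E = halfFourierInt φ E + conj (halfFourierInt φ E) := by
    rw [h1, halfFourierInt, fourierInt,
      ← intervalIntegral.integral_Iic_add_Ioi (b := (0 : ℝ)) (integrable_mul_cexp hi E).integrableOn
        (integrable_mul_cexp hi E).integrableOn]
  rw [h2, Complex.add_re, Complex.conj_re, two_mul]

lemma integral_fourierInt_mul_gaussian (hi : Integrable φ) {a : ℝ} (ha : 0 < a) :
    ∫ E : ℝ, fourierInt φ E * (Real.exp (-a * E ^ 2) : ℂ)
      = ∫ t : ℝ, φ t * ((Real.sqrt (Real.pi / a) * Real.exp (-(1 / (4 * a)) * t ^ 2) : ℝ) : ℂ) := by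
  have hG : Integrable fun E : ℝ => (Real.exp (-a * E ^ 2) : ℂ) :=
    (integrable_exp_neg_mul_sq ha).ofReal
  have hprod : Integrable (Function.uncurry fun E t : ℝ =>
      φ t * cexp (-(I * (t * E))) * (Real.exp (-a * E ^ 2) : ℂ)) (volume.prod volume) := by
    have h3 : Integrable (fun z : ℝ × ℝ => (Real.exp (-a * z.1 ^ 2) : ℂ) * φ z.2)
      (volume.prod volume) := hG.mul_prod hi
    have h4 : Continuous fun z : ℝ × ℝ => cexp (-(I * (z.2 * z.1))) := by fun_prop
    refine (h3.mul_bdd (c := 1) h4.aestronglyMeasurable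
      (.of_forall fun z => (norm_cexp_neg_I_mul z.2 z.1).le)).congr (.of_forall fun z => ?_)
    simp only [Function.uncurry]
    ring
  have h1 : ∀ E : ℝ, fourierInt φ E * (Real.exp (-a * E ^ 2) : ℂ)
      = ∫ t : ℝ, φ t * cexp (-(I * (t * E))) * (Real.exp (-a * E ^ 2) : ℂ) :=
    fun E => by rw [integral_mul_const]; rfl
  simp only [h1]
  rw [integral_integral_swap hprod]
  congr 1
  ext t
  have h2 := fourierIntegral_gaussian (b := (a : ℂ)) (by simpa using ha) (-t)
  have h3 : ∀ x : ℝ, φ t * cexp (-(I * (t * x))) * (Real.exp (-a * x ^ 2) : ℂ)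
      = φ t * (cexp (I * -t * x) * cexp (-a * x ^ 2)) := by
    intro x
    push_cast
    rw [mul_assoc]
    congr 3
    ring
  simp only [h3]
  rw [integral_const_mul, h2]
  congr 1
  rw [← Complex.ofReal_div, Real.sqrt_eq_rpow, Complex.ofReal_mul,
    Complex.ofReal_cpow (by positivity), Complex.ofReal_exp]
  push_cast
  congr 2
  field_simp

/-- The bound does not depend on `a`, because the transformed Gaussian has total mass 2π for every
width. -/
lemma norm_integral_fourierInt_mul_gaussian_le (hi : Integrable φ) {C : ℝ}
    (hC : ∀ t, ‖φ t‖ ≤ C) {a : ℝ} (ha : 0 < a) :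
    ‖∫ E : ℝ, fourierInt φ E * (Real.exp (-a * E ^ 2) : ℂ)‖ ≤ C * (2 * Real.pi) := by
  rw [integral_fourierInt_mul_gaussian hi ha]
  have hb : 0 < 1 / (4 * a) := by positivity
  have hg : ∫ t : ℝ, C * (Real.sqrt (Real.pi / a) * Real.exp (-(1 / (4 * a)) * t ^ 2))
      = C * (2 * Real.pi) := by
    rw [integral_const_mul, integral_const_mul, integral_gaussian, ← Real.sqrt_mul (by positivity)]
    congr 1
    rw [show Real.pi / a * (Real.pi / (1 / (4 * a))) = (2 * Real.pi) ^ 2 by field_simp; ring,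
      Real.sqrt_sq (by positivity)]
  rw [← hg]
  refine norm_integral_le_of_norm_le
    (((integrable_exp_neg_mul_sq hb).const_mul _).const_mul _) (.of_forall fun t => ?_)
  rw [norm_mul, Complex.norm_real, Real.norm_of_nonneg (by positivity)]
  exact mul_le_mul_of_nonneg_right (hC t) (by positivity)

lemma norm_fourierInt_le (φ : ℝ → ℂ) (E : ℝ) : ‖fourierInt φ E‖ ≤ ∫ t, ‖φ t‖ := by
  refine (norm_integral_le_integral_norm _).trans_eq ?_
  simp only [norm_mul, norm_cexp_neg_I_mul, mul_one]

lemma norm_eq_re_of_nonneg {z : ℂ} (hz : 0 ≤ z) : ‖z‖ = z.re := by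
  obtain ⟨h1, h2⟩ := Complex.nonneg_iff.1 hz
  rw [← Complex.re_add_im z, ← h2]
  simpa using h1

/-- Non-negativity turns the uniform bound on the Gaussian-weighted integrals into a uniform bound
on the integrals of the norm over bounded intervals. -/
lemma integrable_fourierInt (hi : Integrable φ) {C : ℝ} (hC : ∀ t, ‖φ t‖ ≤ C)
    (hpos : ∀ E, 0 ≤ fourierInt φ E) : Integrable (fourierInt φ) := by
  have hc := continuous_fourierInt hi
  have hG : ∀ a : ℝ, 0 < a →
      Integrable fun E : ℝ => fourierInt φ E * (Real.exp (-a * E ^ 2) : ℂ) := fun a ha =>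
    (integrable_exp_neg_mul_sq ha).ofReal.bdd_mul hc.aestronglyMeasurable
      (.of_forall fun E => norm_fourierInt_le φ E)
  refine integrable_of_intervalIntegral_norm_bounded (l := atTop)
    (a := fun n : ℕ => -((n : ℝ) + 1)) (b := fun n : ℕ => (n : ℝ) + 1)
    (Real.exp 1 * (C * (2 * Real.pi))) (fun n => (hc.integrableOn_Ioc)) ?_ ?_ (.of_forall fun n => ?_)
  · exact tendsto_neg_atTop_atBot.comp (tendsto_natCast_atTop_atTop.atTop_add tendsto_const_nhds)
  · exact tendsto_natCast_atTop_atTop.atTop_add tendsto_const_nhds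
  set m : ℝ := (n : ℝ) + 1
  have hm : 0 < m := by positivity
  -- With the parameter 1/m², the Gaussian is at least exp(-1) on (-m, m]; hence the factor exp 1 in
  -- the bound.
  have ha : 0 < 1 / m ^ 2 := by positivity
  have h1 : ∫ E : ℝ, ‖fourierInt φ E * (Real.exp (-(1 / m ^ 2) * E ^ 2) : ℂ)‖
      ≤ C * (2 * Real.pi) := by
    refine le_trans ?_ (norm_integral_fourierInt_mul_gaussian_le hi hC ha)
    refine le_trans (le_of_eq ?_) (Complex.re_le_norm _)
    have h2 := integral_re (hG _ ha)
    rw [RCLike.re_eq_complex_re] at h2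
    rw [← h2]
    congr 1
    ext E
    refine norm_eq_re_of_nonneg (mul_nonneg (hpos E) ?_)
    exact_mod_cast (Real.exp_pos _).le
  rw [intervalIntegral.integral_of_le (by linarith)]
  refine le_trans ?_ (mul_le_mul_of_nonneg_left h1 (Real.exp_pos 1).le)
  rw [← integral_const_mul]
  refine le_trans (setIntegral_mono_on hc.norm.integrableOn_Ioc
    ((hG _ ha).norm.const_mul (Real.exp 1)).integrableOn measurableSet_Ioc fun E hE => ?_)
    (setIntegral_le_integral ((hG _ ha).norm.const_mul (Real.exp 1)) (.of_forall fun E => ?_))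
  · rw [norm_mul, Complex.norm_real, Real.norm_of_nonneg (Real.exp_pos _).le,
      mul_left_comm, ← Real.exp_add]
    refine le_mul_of_one_le_right (norm_nonneg _) (Real.one_le_exp ?_)
    have : E ^ 2 ≤ m ^ 2 := sq_le_sq' hE.1.le hE.2
    have h3 : 1 / m ^ 2 * E ^ 2 ≤ 1 := by
      rw [one_div, inv_mul_le_iff₀ (by positivity)]; linarith
    linarith
  · positivity

lemma fourierInt_inversion (hφ : Continuous φ) (hi : Integrable φ)
    (hp : Integrable (fourierInt φ)) (t : ℝ) :
    φ t = (1 / (2 * Real.pi) : ℝ) * ∫ E : ℝ, fourierInt φ E * cexp (I * (t * E)) := by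
  have hpi : (0 : ℝ) < 2 * Real.pi := by positivity
  have hF : FourierTransform.fourier φ = fun w => fourierInt φ (2 * Real.pi * w) :=
    funext (fourierInt_eq_fourier φ)
  have h1 := hφ.fourierInv_fourier_eq hi (by rw [hF]; exact hp.comp_mul_left' hpi.ne')
  have h2 := congrFun h1 t
  rw [← h2, Real.fourierInv_eq_fourier_neg, fourierInt_eq_fourier, hF, fourierInt]
  have h3 := Measure.integral_comp_mul_left
    (fun E : ℝ => fourierInt φ E * cexp (I * (t * E))) (2 * Real.pi)
  rw [abs_of_pos (inv_pos.2 hpi), Complex.real_smul] at h3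
  rw [one_div, ← h3]
  congr 1
  ext x
  congr 2
  push_cast; ring

lemma tendsto_halfFourierInt_regularized (hi : Integrable φ) (E : ℝ) :
    Tendsto (fun n : ℕ => ∫ t in Set.Iic (0 : ℝ),
      φ t * cexp (-(I * (t * E))) * (Real.exp (1 / ((n : ℝ) + 1) * t) : ℂ)) atTop
      (𝓝 (halfFourierInt φ E)) := by
  refine tendsto_integral_of_dominated_convergence (fun t => ‖φ t‖) (fun n => ?_)
    hi.norm.integrableOn (fun n => ?_) (.of_forall fun t => ?_)
  · exact (integrable_mul_cexp hi.integrableOn E).aestronglyMeasurable.mul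
      (by fun_prop : Continuous fun t : ℝ => (Real.exp (1 / ((n : ℝ) + 1) * t) : ℂ)).aestronglyMeasurable
  · filter_upwards [ae_restrict_mem measurableSet_Iic] with t ht
    rw [norm_mul, norm_mul, norm_cexp_neg_I_mul, mul_one, Complex.norm_real,
      Real.norm_of_nonneg (Real.exp_pos _).le]
    refine mul_le_of_le_one_right (norm_nonneg _) (Real.exp_le_one_iff.2 ?_)
    exact mul_nonpos_of_nonneg_of_nonpos (by positivity) ht
  · have h0 := tendsto_one_div_add_atTop_nhds_zero_nat (𝕜 := ℝ)
    have hc : Continuous fun x : ℝ => φ t * cexp (-(I * (t * E))) * (Real.exp (x * t) : ℂ) := by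
      fun_prop
    have h1 := (hc.tendsto 0).comp h0
    rw [zero_mul, Real.exp_zero, Complex.ofReal_one, mul_one] at h1
    exact h1

/-- Insert the inversion formula for φ and exchange the integrals; the damping exp(ηt) is what
permits Fubini, and the t-integral then gives the resolvent kernel. -/
lemma integral_regularized_eq (hφ : Continuous φ) (hi : Integrable φ)
    (hp : Integrable (fourierInt φ)) {η : ℝ} (hη : 0 < η) (E : ℝ) :
    ∫ t in Set.Iic (0 : ℝ), φ t * cexp (-(I * (t * E))) * (Real.exp (η * t) : ℂ)
      = (1 / (2 * Real.pi) : ℝ) * ∫ x : ℝ, fourierInt φ x / (η + I * (x - E)) := by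
  have h1 : ∀ t : ℝ, φ t * cexp (-(I * (t * E))) * (Real.exp (η * t) : ℂ)
      = (1 / (2 * Real.pi) : ℝ) * ∫ x : ℝ, fourierInt φ x * cexp ((η + I * (x - E)) * t) := by
    intro t
    rw [fourierInt_inversion hφ hi hp t, mul_assoc, mul_assoc, ← integral_mul_const]
    congr 2
    ext x
    rw [Complex.ofReal_exp, mul_assoc, ← Complex.exp_add, ← Complex.exp_add]
    congr 2
    push_cast; ring
  simp only [h1]
  rw [integral_const_mul, integral_integral_swap]
  · congr 2
    ext x
    have hre : 0 < ((η : ℂ) + I * (x - E)).re := by simpa using hη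
    rw [integral_const_mul, integral_exp_mul_complex_Iic hre]
    simp [div_eq_mul_inv]
  · have h2 : IntegrableOn (fun t : ℝ => Real.exp (η * t)) (Set.Iic 0) :=
      integrableOn_exp_mul_Iic hη 0
    have h3 : Integrable (fun z : ℝ × ℝ => (Real.exp (η * z.1) : ℂ) * fourierInt φ z.2)
      ((volume.restrict (Set.Iic 0)).prod volume) := Integrable.mul_prod (Integrable.ofReal h2) hp
    have h4 : Continuous fun z : ℝ × ℝ => cexp (I * (z.1 * (z.2 - E))) := by fun_prop
    refine (h3.mul_bdd (c := 1) h4.aestronglyMeasurable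
      (.of_forall fun z => ?_)).congr (.of_forall fun z => ?_)
    · have := norm_cexp_I_mul z.1 (z.2 - E)
      push_cast at this
      exact this.le
    · simp only [Function.uncurry]
      rw [mul_comm (Complex.ofReal _), mul_assoc, Complex.ofReal_exp, ← Complex.exp_add]
      congr 2
      push_cast; ring

/-- The limit η → 0 of the regularized formula. It is dominated because |x - E| ≥ r wherever the
transform is nonzero. -/
lemma halfFourierInt_eq_of_gap (hφ : Continuous φ) (hi : Integrable φ)
    (hp : Integrable (fourierInt φ)) {E r : ℝ} (hr : 0 < r)
    (hgap : ∀ x, |x - E| < r → fourierInt φ x = 0) :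
    halfFourierInt φ E = (1 / (2 * Real.pi) : ℝ) * ∫ x : ℝ, fourierInt φ x / (I * (x - E)) := by
  refine tendsto_nhds_unique (tendsto_halfFourierInt_regularized hi E) ?_
  have h1 : ∀ n : ℕ, (0 : ℝ) < 1 / ((n : ℝ) + 1) := fun n => by positivity
  simp only [fun n : ℕ => integral_regularized_eq hφ hi hp (h1 n) E]
  refine Tendsto.const_mul _ ?_
  have hc := continuous_fourierInt hi
  refine tendsto_integral_of_dominated_convergence (fun x => r⁻¹ * ‖fourierInt φ x‖) (fun n => ?_)
    (hp.norm.const_mul _) (fun n => .of_forall fun x => ?_) (.of_forall fun x => ?_)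
  · refine (hc.div (by fun_prop) fun x => ?_).aestronglyMeasurable
    intro h
    have h5 := congrArg Complex.re h
    have h6 := h1 n
    simp only [Complex.add_re, Complex.ofReal_re, Complex.zero_re] at h5
    rw [show (I * ((x : ℂ) - E)).re = 0 by simp, add_zero] at h5
    exact h6.ne' h5
  · by_cases hx : |x - E| < r
    · simp [hgap x hx]
    · rw [norm_div, div_eq_inv_mul]
      refine mul_le_mul_of_nonneg_right (inv_anti₀ hr ?_) (norm_nonneg _)
      refine (not_lt.1 hx).trans ?_
      refine le_trans (le_of_eq ?_) (Complex.abs_im_le_norm _)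
      simp
  · by_cases hx : |x - E| < r
    · simp [hgap x hx]
    · have hne : I * ((x : ℂ) - E) ≠ 0 := by
        refine mul_ne_zero I_ne_zero fun h => hx ?_
        rw [← Complex.ofReal_sub, Complex.ofReal_eq_zero] at h
        rw [h]; simpa using hr
      have h0 := (Complex.continuous_ofReal.tendsto 0).comp
        (tendsto_one_div_add_atTop_nhds_zero_nat (𝕜 := ℝ))
      have := (h0.add_const (I * ((x : ℂ) - E)))
      rw [Complex.ofReal_zero, zero_add] at this
      exact Tendsto.div tendsto_const_nhds this hne

/-- The half-line Fourier integral of a function of positive type does not vanish on an interval. -/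
lemma exists_halfFourierInt_ne_zero [CompleteSpace H] (hv : ∀ s t, ⟪v s, v t⟫_ℂ = φ (t - s))
    (hφ : Continuous φ) (hi : Integrable φ) (h0 : φ 0 ≠ 0) {a b : ℝ} (hab : a < b) :
    ∃ E ∈ Set.Ioo a b, halfFourierInt φ E ≠ 0 := by
  by_contra! hcon
  have hpos := fourierInt_nonneg hv hφ hi
  have hp := integrable_fourierInt hi (norm_positiveType_le hv) hpos
  -- The full transform is twice the real part of the half-line one, so it has a gap on (a, b).
  have hz : ∀ x ∈ Set.Ioo a b, fourierInt φ x = 0 := by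
    intro x hx
    have h1 := two_mul_re_halfFourierInt hv hi x
    rw [hcon x hx] at h1
    refine Complex.ext ?_ (Complex.nonneg_iff.1 (hpos x)).2.symm
    simpa using h1.symm
  -- Thirds give two comparison points, a + w and b - w, at distance w from each other and from the
  -- ends of the gap.
  set w := (b - a) / 3 with hw
  have hwpos : 0 < w := by rw [hw]; linarith
  have hgap : ∀ E ∈ Set.Icc (a + w) (b - w), ∫ x : ℝ, fourierInt φ x / (I * (x - E)) = 0 := by
    intro E hE
    have h2 := halfFourierInt_eq_of_gap hφ hi hp hwpos (E := E) fun x hx => hz x (by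
      rw [abs_lt] at hx
      exact ⟨by linarith [hE.1], by linarith [hE.2]⟩)
    rw [hcon E ⟨by linarith [hE.1], by linarith [hE.2]⟩] at h2
    have : (((1 / (2 * Real.pi) : ℝ)) : ℂ) ≠ 0 := by
      rw [Complex.ofReal_ne_zero]; positivity
    exact (mul_eq_zero.1 h2.symm).resolve_left this
  have hint : ∀ E ∈ Set.Icc (a + w) (b - w),
      Integrable fun x : ℝ => fourierInt φ x / (I * (x - E)) := by
    intro E hE
    refine (hp.norm.const_mul w⁻¹).mono' ?_ (.of_forall fun x => ?_)
    · exact ((continuous_fourierInt hi).measurable.div (by fun_prop)).aestronglyMeasurable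
    · by_cases hx : x ∈ Set.Ioo a b
      · simp [hz x hx]
      · rw [norm_div, div_eq_inv_mul]
        refine mul_le_mul_of_nonneg_right (inv_anti₀ hwpos ?_) (norm_nonneg _)
        refine le_trans ?_ (Complex.abs_im_le_norm _)
        have : (I * ((x : ℂ) - E)).im = x - E := by simp
        rw [this, le_abs]
        rw [Set.mem_Ioo, not_and_or, not_lt, not_lt] at hx
        rcases hx with hx | hx
        · right; linarith [hE.1]
        · left; linarith [hE.2]
  have hE1 : a + w ∈ Set.Icc (a + w) (b - w) := ⟨le_rfl, by rw [hw]; linarith⟩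
  have hE2 : b - w ∈ Set.Icc (a + w) (b - w) := ⟨by rw [hw]; linarith, le_rfl⟩
  -- The Stieltjes transform is compared at the two points. The difference of the kernels is w / ((x
  -- - (b - w))(x - (a + w))), which is positive outside (a, b), as both factors have the same sign
  -- there. The difference integrates to zero, so the density vanishes almost everywhere, and
  -- inversion then contradicts φ(0) ≠ 0.
  have hsub : ∀ x : ℝ, I * (fourierInt φ x / (I * (x - (b - w : ℝ))) -
      fourierInt φ x / (I * (x - (a + w : ℝ))))
      = (((fourierInt φ x).re * (w / ((x - (b - w)) * (x - (a + w)))) : ℝ) : ℂ) := by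
    intro x
    by_cases hx : x ∈ Set.Ioo a b
    · simp [hz x hx]
    · have hre : fourierInt φ x = (((fourierInt φ x).re : ℝ) : ℂ) :=
        Complex.ext (by simp) (by simpa using! (Complex.nonneg_iff.1 (hpos x)).2.symm)
      have hn1 : x - (b - w) ≠ 0 := fun h => hx ⟨by linarith [hE2.1], by linarith⟩
      have hn2 : x - (a + w) ≠ 0 := fun h => hx ⟨by linarith, by linarith [hE1.2]⟩
      have hn1' : (x : ℂ) - ((b - w : ℝ) : ℂ) ≠ 0 := by exact_mod_cast hn1
      have hn2' : (x : ℂ) - ((a + w : ℝ) : ℂ) ≠ 0 := by exact_mod_cast hn2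
      have hbw : (b - w) - (a + w) = w := by rw [hw]; ring
      have hbw' : ((b - w : ℝ) : ℂ) - ((a + w : ℝ) : ℂ) = w := by exact_mod_cast hbw
      conv_lhs => rw [hre]
      rw [Complex.ofReal_mul, Complex.ofReal_div, Complex.ofReal_mul, Complex.ofReal_sub x,
        Complex.ofReal_sub x, ← hbw']
      field_simp
      ring
  have hzero : ∫ x : ℝ, (fourierInt φ x).re * (w / ((x - (b - w)) * (x - (a + w)))) = 0 := by
    have h3 : ∫ x : ℝ, I * (fourierInt φ x / (I * (x - (b - w : ℝ))) -
      fourierInt φ x / (I * (x - (a + w : ℝ)))) = 0 := by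
      rw [integral_const_mul, integral_sub (hint _ hE2) (hint _ hE1), hgap _ hE1, hgap _ hE2]
      simp
    simp only [hsub] at h3
    rw [integral_complex_ofReal] at h3
    exact_mod_cast h3
  have hnn : ∀ x : ℝ, 0 ≤ (fourierInt φ x).re * (w / ((x - (b - w)) * (x - (a + w)))) := by
    intro x
    by_cases hx : x ∈ Set.Ioo a b
    · simp [hz x hx]
    · refine mul_nonneg (Complex.nonneg_iff.1 (hpos x)).1 (div_nonneg hwpos.le ?_)
      rw [Set.mem_Ioo, not_and_or, not_lt, not_lt] at hx
      rcases hx with hx | hx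
      · exact mul_nonneg_of_nonpos_of_nonpos (by linarith [hE2.1]) (by linarith)
      · exact mul_nonneg (by linarith) (by linarith [hE1.2])
  have hintr : Integrable fun x : ℝ =>
      (fourierInt φ x).re * (w / ((x - (b - w)) * (x - (a + w)))) := by
    have h4 := (((hint _ hE2).sub (hint _ hE1)).const_mul I).re
    refine h4.congr (.of_forall fun x => ?_)
    have := congrArg Complex.re (hsub x)
    rw [Complex.ofReal_re] at this
    exact this
  have hae := (integral_eq_zero_iff_of_nonneg hnn hintr).1 hzero
  have hpz : fourierInt φ =ᵐ[volume] 0 := by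
    filter_upwards [hae] with x hx
    by_cases hx' : x ∈ Set.Ioo a b
    · exact hz x hx'
    · have hn1 : x - (b - w) ≠ 0 := fun h => hx' ⟨by linarith [hE2.1], by linarith⟩
      have hn2 : x - (a + w) ≠ 0 := fun h => hx' ⟨by linarith, by linarith [hE1.2]⟩
      refine Complex.ext ?_ (Complex.nonneg_iff.1 (hpos x)).2.symm
      exact (mul_eq_zero.1 hx).resolve_right
        (div_ne_zero hwpos.ne' (mul_ne_zero hn1 hn2))
  apply h0
  rw [fourierInt_inversion hφ hi hp 0]
  rw [integral_congr_ae (g := fun _ => 0)]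
  · simp
  · filter_upwards [hpz] with x hx
    simp [hx]

lemma exists_fourierInt_ne_zero [CompleteSpace H] (hv : ∀ s t, ⟪v s, v t⟫_ℂ = φ (t - s))
    (hφ : Continuous φ) (hi : Integrable φ) (h0 : φ 0 ≠ 0) : ∃ E, fourierInt φ E ≠ 0 := by
  by_contra! hcon
  have hp := integrable_fourierInt hi (norm_positiveType_le hv) (fourierInt_nonneg hv hφ hi)
  apply h0
  rw [fourierInt_inversion hφ hi hp 0]
  simp [hcon]

end FourierPositive


/-! ### Correlations and the Cauchy kernel. -/

section Convolution
variable {φ X : ℝ → ℂ}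

/-- Fubini and a translation. The argument -E appears because X enters as a correlation, not as a
convolution. -/
lemma fourierInt_correlation (hX : Integrable X) (hi : Integrable φ) (E : ℝ) :
    fourierInt (fun t => ∫ s : ℝ, X s * φ (t + s)) E = fourierInt X (-E) * fourierInt φ E := by
  have hprod : Integrable (Function.uncurry fun t s : ℝ =>
      X s * φ (t + s) * cexp (-(I * (t * E)))) (volume.prod volume) := by
    have h1 : Integrable (fun z : ℝ × ℝ => X z.1 * φ z.2) (volume.prod volume) := hX.mul_prod hi
    -- The shear (s, t) ↦ (s, s + t) preserves the product measure and carries integrability of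
    -- X(s)φ(t) over to X(s)φ(t + s).
    have h2 := (measurePreserving_prod_add volume (volume : Measure ℝ)).integrable_comp_emb
      (MeasurableEquiv.shearAddRight ℝ).measurableEmbedding (g := fun z : ℝ × ℝ => X z.1 * φ z.2)
    have h3 := (h2.2 h1).swap
    refine (h3.mul_bdd (c := 1) (by fun_prop : Continuous fun z : ℝ × ℝ =>
      cexp (-(I * (z.1 * E)))).aestronglyMeasurable
      (.of_forall fun z => (norm_cexp_neg_I_mul z.1 E).le)).congr (.of_forall fun z => ?_)
    simp [Function.uncurry, add_comm]
  have h1 : ∀ t : ℝ, (∫ s : ℝ, X s * φ (t + s)) * cexp (-(I * (t * E)))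
      = ∫ s : ℝ, X s * φ (t + s) * cexp (-(I * (t * E))) := fun t => by rw [integral_mul_const]
  rw [fourierInt]
  simp only [h1]
  rw [integral_integral_swap hprod, fourierInt, ← integral_mul_const]
  congr 1
  ext s
  rw [fourierInt, ← integral_const_mul,
    ← integral_add_right_eq_self (fun t : ℝ => X s * cexp (-(I * (s * (-E : ℝ)))) *
      (φ t * cexp (-(I * (t * E))))) s]
  congr 1
  ext t
  have : cexp (-(I * (t * E))) = cexp (-(I * (s * (-E : ℝ)))) * cexp (-(I * ((t + s : ℝ) * E))) := by
    rw [← Complex.exp_add]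
    congr 1
    push_cast; ring
  rw [this]
  ring

/-- The Fourier integral of `exp(-β |E|)`. -/
lemma fourierInt_exp_neg_abs {β : ℝ} (hβ : 0 < β) (s : ℝ) :
    fourierInt (fun E => (Real.exp (-(β * |E|)) : ℂ)) s = ((2 * β / (β ^ 2 + s ^ 2) : ℝ) : ℂ) := by
  have h1 : ∀ x ∈ Set.Iic (0 : ℝ), (Real.exp (-(β * |x|)) : ℂ) * cexp (-(I * (x * s)))
      = cexp ((β - I * s) * x) := by
    intro x hx
    rw [abs_of_nonpos hx, Complex.ofReal_exp, ← Complex.exp_add]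
    congr 1; push_cast; ring
  have h2 : ∀ x ∈ Set.Ioi (0 : ℝ), (Real.exp (-(β * |x|)) : ℂ) * cexp (-(I * (x * s)))
      = cexp ((-β - I * s) * x) := by
    intro x hx
    rw [abs_of_pos hx, Complex.ofReal_exp, ← Complex.exp_add]
    congr 1; push_cast; ring
  have hr1 : 0 < ((β : ℂ) - I * s).re := by simpa using hβ
  have hr2 : (-(β : ℂ) - I * s).re < 0 := by simpa using hβ
  rw [fourierInt, ← intervalIntegral.integral_Iic_add_Ioi (b := (0 : ℝ)),
    setIntegral_congr_fun measurableSet_Iic h1, setIntegral_congr_fun measurableSet_Ioi h2,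
    integral_exp_mul_complex_Iic hr1, integral_exp_mul_complex_Ioi hr2]
  · have n1 : (β : ℂ) - I * s ≠ 0 := fun h => by rw [h] at hr1; simp at hr1
    have n2 : -(β : ℂ) - I * s ≠ 0 := fun h => by rw [h] at hr2; simp at hr2
    have n3 : (β : ℂ) ^ 2 + (s : ℂ) ^ 2 ≠ 0 := by
      have : (0 : ℝ) < β ^ 2 + s ^ 2 := by positivity
      exact_mod_cast this.ne'
    push_cast
    simp only [mul_zero, Complex.exp_zero]
    field_simp
    linear_combination (-2 * (β : ℂ) * s ^ 2) * I_sq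
  · exact (integrableOn_exp_mul_complex_Iic hr1 0).congr_fun (fun x hx => (h1 x hx).symm)
      measurableSet_Iic
  · exact (integrableOn_exp_mul_complex_Ioi hr2 0).congr_fun (fun x hx => (h2 x hx).symm)
      measurableSet_Ioi

lemma integrable_exp_neg_abs {β : ℝ} (hβ : 0 < β) :
    Integrable fun E : ℝ => Real.exp (-(β * |E|)) := by
  have h := integrableOn_exp_mul_Iic hβ 0
  have h' := integrableOn_exp_mul_Ioi (neg_neg_of_pos hβ) 0
  rw [← integrableOn_univ, ← Set.Iic_union_Ioi (a := (0 : ℝ))]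
  refine IntegrableOn.union (h.congr_fun (fun x hx => ?_) measurableSet_Iic)
    (h'.congr_fun (fun x hx => ?_) measurableSet_Ioi)
  · simp only [abs_of_nonpos (Set.mem_Iic.1 hx)]; congr 1; ring
  · simp only [abs_of_pos (Set.mem_Ioi.1 hx)]; congr 1; ring

lemma integrable_cauchyKernel {β : ℝ} (hβ : 0 < β) :
    Integrable fun s : ℝ => ((2 * β / (β ^ 2 + s ^ 2) : ℝ) : ℂ) := by
  suffices h2 : Integrable fun s : ℝ => 2 * β / (β ^ 2 + s ^ 2) from h2.ofReal
  have h := (integrable_inv_one_add_sq.comp_mul_left' (inv_ne_zero hβ.ne')).const_mul (2 / β)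
  refine h.congr (.of_forall fun s => ?_)
  simp only
  field_simp

/-- A superposition of characters with integrable weight; under the functional calculus the
characters become the unitary group exp(isH₁). -/
lemma exp_neg_abs_eq {β : ℝ} (hβ : 0 < β) (E : ℝ) :
    (Real.exp (-(β * |E|)) : ℂ) = (1 / (2 * Real.pi) : ℝ) *
      ∫ s : ℝ, ((2 * β / (β ^ 2 + s ^ 2) : ℝ) : ℂ) * cexp (I * (E * s)) := by
  have hF := funext (fourierInt_exp_neg_abs hβ)
  have h := fourierInt_inversion (φ := fun E => (Real.exp (-(β * |E|)) : ℂ))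
    (by fun_prop) (integrable_exp_neg_abs hβ).ofReal (by rw [hF]; exact integrable_cauchyKernel hβ) E
  rw [hF] at h
  exact h

end Convolution

/-! ### The exponential of an operator on an eigenvector. -/

section Eigen

lemma exp_apply_of_eigenvector {V : Type*} [NormedAddCommGroup V] [NormedSpace ℂ V]
    [CompleteSpace V] (A : V →L[ℂ] V) {z : ℂ} {x : V} (h : A x = z • x) :
    NormedSpace.exp A x = cexp z • x := by
  let +nondep : NormedAlgebra ℚ (V →L[ℂ] V) := .restrictScalars ℚ ℂ _
  have hpow : ∀ n : ℕ, (A ^ n) x = z ^ n • x := by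
    intro n
    induction n with
    | zero => simp
    | succ n ih => rw [pow_succ', ContinuousLinearMap.mul_def, ContinuousLinearMap.comp_apply, ih,
        map_smul, h, smul_smul, pow_succ]
  have h1 := (NormedSpace.exp_series_hasSum_exp' (𝕂 := ℂ) A).mapL (ContinuousLinearMap.apply ℂ V x)
  have h2 := (NormedSpace.exp_series_hasSum_exp' (𝕂 := ℂ) z).smul_const x
  rw [← Complex.exp_eq_exp_ℂ] at h2
  refine h1.unique ?_
  convert h2 using 2 with n
  simp [hpow, smul_smul]

end Eigen

/-! ### The thermal factor L² in terms of the one-particle evolution. -/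

namespace Reservoir
variable {d : ℕ} (R : Reservoir d)

/-- The function exp(-βx) has no Fourier representation on the whole line, but on x ≥ c it agrees
with exp(-βc) exp(-β|x - c|), which has one. -/
lemma inner_L_L {c : ℝ} (hc : ∀ k, c ≤ R.ω k) (x y : OneParticle d) :
    ⟪x, R.L (R.L y)⟫_ℂ = (Real.exp (-(R.β * c)) * (1 / (2 * Real.pi)) : ℝ) *
      ∫ s : ℝ, ((2 * R.β / (R.β ^ 2 + s ^ 2) : ℝ) : ℂ) * cexp (-(I * (s * c))) *
        ⟪x, R.S₀ s y⟫_ℂ := by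
  have hLL : R.L * R.L = funH R.ω fun x => cexp (-(R.β * x / 2)) * cexp (-(R.β * x / 2)) :=
    funH_mul R.memLp_L R.memLp_L
  have hm : MemLp (fun k => cexp (-(R.β * (R.ω k : ℂ) / 2)) * cexp (-(R.β * (R.ω k : ℂ) / 2))) ⊤
    (volume : Measure (EuclideanSpace ℝ (Fin d))) := R.memLp_L.mul R.memLp_L
  have h1 : ⟪x, R.L (R.L y)⟫_ℂ = ∫ k, cexp (-(R.β * (R.ω k : ℂ) / 2)) *
      cexp (-(R.β * (R.ω k : ℂ) / 2)) * (conj (x k) * y k) := by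
    rw [← ContinuousLinearMap.comp_apply, ← ContinuousLinearMap.mul_def, hLL]
    exact inner_funH (m := fun x : ℝ => cexp (-(R.β * x / 2)) * cexp (-(R.β * x / 2))) hm x y
  have h2 : ∀ s, ⟪x, R.S₀ s y⟫_ℂ = ∫ k, cexp (I * (s * R.ω k)) * (conj (x k) * y k) :=
    fun s => inner_funH (m := fun z : ℝ => cexp (I * (s * z))) (R.memLp_S₀ s) x y
  have hi : Integrable (fun k => conj (x k) * y k) := by
    refine (MeasureTheory.L2.integrable_inner (𝕜 := ℂ) x y).congr (.of_forall fun k => ?_)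
    simp [RCLike.inner_apply, mul_comm]
  rw [h1]
  have h7 : ∀ s : ℝ, ((2 * R.β / (R.β ^ 2 + s ^ 2) : ℝ) : ℂ) * cexp (-(I * (s * c))) *
      ⟪x, R.S₀ s y⟫_ℂ = ∫ k, ((2 * R.β / (R.β ^ 2 + s ^ 2) : ℝ) : ℂ) * cexp (-(I * (s * c))) *
        (cexp (I * (s * R.ω k)) * (conj (x k) * y k)) := fun s => by
    rw [h2, integral_const_mul]
  simp only [h7]
  have hω := R.measurable_ω
  have hprod : Integrable (Function.uncurry fun (s : ℝ) (k : EuclideanSpace ℝ (Fin d)) =>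
      ((2 * R.β / (R.β ^ 2 + s ^ 2) : ℝ) : ℂ) * cexp (-(I * (s * c))) *
        (cexp (I * (s * R.ω k)) * (conj (x k) * y k))) (volume.prod volume) := by
    have h3 := (integrable_cauchyKernel R.β_pos).mul_prod hi
    have h4 : Measurable fun z : ℝ × EuclideanSpace ℝ (Fin d) =>
      cexp (I * (z.1 * (R.ω z.2 - c : ℝ))) := by fun_prop
    refine (h3.mul_bdd (c := 1) h4.aestronglyMeasurable
      (.of_forall fun z => (norm_cexp_I_mul z.1 _).le)).congr (.of_forall fun z => ?_)
    simp only [Function.uncurry]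
    have : cexp (I * (z.1 * (R.ω z.2 - c : ℝ)))
        = cexp (-(I * (z.1 * c))) * cexp (I * (z.1 * R.ω z.2)) := by
      rw [← Complex.exp_add]; congr 1; push_cast; ring
    rw [this]
    ring
  rw [integral_integral_swap hprod, ← integral_const_mul]
  congr 1
  ext k
  have h5 := exp_neg_abs_eq R.β_pos (R.ω k - c)
  have h6 : ∫ s : ℝ, ((2 * R.β / (R.β ^ 2 + s ^ 2) : ℝ) : ℂ) * cexp (-(I * (s * c))) *
        (cexp (I * (s * R.ω k)) * (conj (x k) * y k))
      = (∫ s : ℝ, ((2 * R.β / (R.β ^ 2 + s ^ 2) : ℝ) : ℂ) * cexp (I * ((R.ω k - c : ℝ) * s))) *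
        (conj (x k) * y k) := by
    rw [← integral_mul_const]
    congr 1
    ext s
    have : cexp (I * ((R.ω k - c : ℝ) * s)) = cexp (-(I * (s * c))) * cexp (I * (s * R.ω k)) := by
      rw [← Complex.exp_add]; congr 1; push_cast; ring
    rw [this]
    ring
  have h8 : cexp (-(R.β * (R.ω k : ℂ) / 2)) * cexp (-(R.β * (R.ω k : ℂ) / 2))
      = (Real.exp (-(R.β * c)) : ℂ) * (Real.exp (-(R.β * |R.ω k - c|)) : ℂ) := by
    rw [abs_of_nonneg (sub_nonneg.2 (hc k)), Complex.ofReal_exp, Complex.ofReal_exp,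
      ← Complex.exp_add, ← Complex.exp_add]
    congr 1
    push_cast; ring
  rw [h6, h8, h5, Complex.ofReal_mul]
  ring

/-- The shift of the energy in the component of `g ε`. -/
def shift (ε : Fin 2) : ℝ := ![R.ω₀, 0] ε

/-- The form factor is an eigenvector of P₀, with eigenvalue 1 for ε = 0 and 0 for ε = 1, so
exp(-isω₀P₀) acts on it as a phase. -/
lemma S₀_g (ε : Fin 2) (s : ℝ) : R.S₀ s (R.g ε) = cexp (I * (s * R.shift ε)) • R.S s (R.g ε) := by
  have h : ((-(I * (s * R.ω₀)) : ℂ) • R.P₀) (R.g ε) = (-(I * (s * R.shift ε)) : ℂ) • R.g ε := by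
    fin_cases ε
    · simp [shift, R.P₀_g_zero]
    · simp [shift, R.P₀_g_one]
  rw [S, ContinuousLinearMap.mul_def, ContinuousLinearMap.comp_apply, exp_apply_of_eigenvector _ h,
    map_smul, smul_smul, ← Complex.exp_add]
  simp

/-- The correlation function `⟨g_ε, S_t g_ε⟩`. -/
def corr (ε : Fin 2) (t : ℝ) : ℂ := ⟪R.g ε, R.S t (R.g ε)⟫_ℂ

lemma continuous_corr (ε : Fin 2) : Continuous (R.corr ε) := R.continuous_inner_S _ _

lemma inner_S_S_g (ε : Fin 2) (s t : ℝ) :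
    ⟪R.S s (R.g ε), R.S t (R.g ε)⟫_ℂ = R.corr ε (t - s) := R.inner_S_S s t _ _

/-- By `inner_L_L` and `S₀_g`, the function ⟨g_ε, S_t L² g_ε⟩ is a correlation of `corr` with a
modulated Cauchy kernel, so its transform is a product. The scalar factor is the Boltzmann weight at
the shifted energy, continued below the energy bound so that it decays in both directions. -/
lemma innerP_L_L {c : ℝ} (hc : ∀ k, c ≤ R.ω k) (ε : Fin 2) (hi : Integrable (R.corr ε)) (E : ℝ) :
    R.innerP (R.g ε) (R.L (R.L (R.g ε))) E =
      (Real.exp (-(R.β * c)) * Real.exp (-(R.β * |E + R.shift ε - c|)) * (1 / (2 * Real.pi)) : ℝ) *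
        fourierInt (R.corr ε) E := by
  set X : ℝ → ℂ := fun s => ((2 * R.β / (R.β ^ 2 + s ^ 2) : ℝ) : ℂ) *
    cexp (-(I * (s * (c - R.shift ε : ℝ)))) with hX
  have hXi : Integrable X := integrable_mul_cexp (integrable_cauchyKernel R.β_pos) _
  have h1 : ∀ t : ℝ, ⟪R.g ε, R.S t (R.L (R.L (R.g ε)))⟫_ℂ
      = (Real.exp (-(R.β * c)) * (1 / (2 * Real.pi)) : ℝ) * ∫ s : ℝ, X s * R.corr ε (t + s) := by
    intro t
    -- S_t is moved to the left vector, so that L² stands next to g_ε.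
    have h2 := R.inner_S_S (-t) 0 (R.g ε) (R.L (R.L (R.g ε)))
    rw [S_zero, one_apply_eq_self, zero_sub, neg_neg] at h2
    rw [← h2, R.inner_L_L hc]
    congr 2
    ext s
    rw [S₀_g, inner_smul_right, inner_S_S_g, hX]
    have : cexp (-(I * (s * (c - R.shift ε : ℝ))))
        = cexp (-(I * (s * c))) * cexp (I * (s * R.shift ε)) := by
      rw [← Complex.exp_add]; congr 1; push_cast; ring
    simp only [this]
    rw [sub_neg_eq_add, add_comm s t]
    ring
  have h3 : fourierInt X (-E) = (2 * Real.pi : ℝ) * (Real.exp (-(R.β * |E + R.shift ε - c|)) : ℂ) := by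
    rw [exp_neg_abs_eq R.β_pos, ← mul_assoc, ← Complex.ofReal_mul,
      mul_one_div_cancel (by positivity), Complex.ofReal_one, one_mul, fourierInt]
    congr 1
    ext s
    rw [hX]
    simp only
    rw [mul_assoc, ← Complex.exp_add]
    congr 2
    push_cast; ring
  rw [innerP]
  simp only [h1, mul_assoc]
  rw [integral_const_mul]
  have h4 := fourierInt_correlation hXi hi E
  rw [h3, fourierInt] at h4
  rw [h4]
  have : (Real.pi : ℂ) ≠ 0 := by exact_mod_cast Real.pi_ne_zero
  push_cast
  field_simp

end Reservoir


/-! ### The real part of a resolvent form. -/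

section Resolvent
variable {HS : Type*} [NormedAddCommGroup HS] [InnerProductSpace ℂ HS] [CompleteSpace HS]

lemma bounded_of_tendsto_cocompact {V : Type*} [NormedAddCommGroup V] {f : ℝ → V}
    (hf : Continuous f) {y : V} (h : Tendsto f (cocompact ℝ) (𝓝 y)) : ∃ C, ∀ x, ‖f x‖ ≤ C := by
  let F : ZeroAtInftyContinuousMap ℝ V := ⟨⟨fun x => f x - y, by fun_prop⟩, by
    simpa using h.sub_const y⟩
  obtain ⟨C, hC⟩ := isBounded_iff_forall_norm_le.1 F.isBounded_range
  refine ⟨C + ‖y‖, fun x => ?_⟩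
  have h1 : ‖f x - y‖ ≤ C := hC _ ⟨x, rfl⟩
  calc ‖f x‖ = ‖f x - y + y‖ := by rw [sub_add_cancel]
    _ ≤ _ := (norm_add_le _ _).trans (by linarith)

/-- The real part of `⟨u, z' B B⁺ (1 + z z' B B⁺)⁻¹ u⟩`, where `u = (1 + z z' B B⁺) w`. -/
lemma re_inner_resolvent (B : HS →L[ℂ] HS) (z z' : ℂ) (w : HS) :
    (⟪w + (z * z') • (B * star B) w, z' • (B * star B) w⟫_ℂ).re =
      z'.re * ‖star B w‖ ^ 2 + z.re * ‖z'‖ ^ 2 * ‖(B * star B) w‖ ^ 2 := by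
  have h1 : ⟪w, (B * star B) w⟫_ℂ = ((‖star B w‖ ^ 2 : ℝ) : ℂ) := by
    rw [ContinuousLinearMap.mul_def, ContinuousLinearMap.comp_apply,
      ContinuousLinearMap.star_eq_adjoint, ← ContinuousLinearMap.adjoint_inner_left,
      inner_self_eq_norm_sq_to_K]
    norm_cast
  rw [inner_add_left, inner_smul_right, inner_smul_left, inner_smul_right, h1,
    inner_self_eq_norm_sq_to_K]
  -- Here conj(zz')z' = conj(z)|z'|²: the phase of z' drops out, so the sign of this term is that of
  -- Re z alone.
  have h2 : conj (z * z') * (z' * ((‖(B * star B) w‖ : ℂ)) ^ 2)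
      = conj z * (((‖z'‖ ^ 2 * ‖(B * star B) w‖ ^ 2 : ℝ)) : ℂ) := by
    push_cast
    rw [map_mul, ← Complex.conj_mul' z']
    ring
  change (_ + conj (z * z') * (z' * ((‖(B * star B) w‖ : ℂ)) ^ 2)).re = _
  rw [h2]
  simp only [Complex.add_re, Complex.mul_re, Complex.ofReal_re, Complex.ofReal_im, Complex.conj_re]
  ring

end Resolvent

/-! ### The drift: integrability, positivity and coercivity. -/

namespace LowDensityModel
variable {d : ℕ} {HS : Type*} [NormedAddCommGroup HS] [InnerProductSpace ℂ HS] [CompleteSpace HS]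
variable (M : LowDensityModel d HS)

lemma integrable_corr (ε : Fin 2) : Integrable (M.corr ε) :=
  M.integrable_K _ (M.g_mem_K ε) _ (M.g_mem_K ε)

/-- The density `⟨g_ε, P_E g_ε⟩`, up to the factor `2π`. -/
def density (ε : Fin 2) (E : ℝ) : ℝ := (fourierInt (M.corr ε) E).re

lemma fourierInt_corr_nonneg (ε : Fin 2) (E : ℝ) : 0 ≤ fourierInt (M.corr ε) E :=
  fourierInt_nonneg (M.inner_S_S_g ε) (M.continuous_corr ε) (M.integrable_corr ε) E

lemma density_nonneg (ε : Fin 2) (E : ℝ) : 0 ≤ M.density ε E :=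
  (Complex.nonneg_iff.1 (M.fourierInt_corr_nonneg ε E)).1

lemma ofReal_density (ε : Fin 2) (E : ℝ) : (M.density ε E : ℂ) = fourierInt (M.corr ε) E :=
  Complex.ext (by simp [density])
    (by simpa using! (Complex.nonneg_iff.1 (M.fourierInt_corr_nonneg ε E)).2)

lemma continuous_density (ε : Fin 2) : Continuous (M.density ε) :=
  Complex.continuous_re.comp (continuous_fourierInt (M.integrable_corr ε))

lemma norm_density_le (ε : Fin 2) (E : ℝ) : ‖M.density ε E‖ ≤ ∫ t, ‖M.corr ε t‖ :=
  (Complex.abs_re_le_norm _).trans (norm_fourierInt_le _ _)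

lemma continuous_γ (ε : Fin 2) : Continuous (M.γ ε) :=
  continuous_halfFourierInt (M.integrable_corr ε)

lemma tendsto_γ (ε : Fin 2) : Tendsto (M.γ ε) (cocompact ℝ) (𝓝 0) :=
  tendsto_halfFourierInt_cocompact (M.corr ε)

lemma re_γ (ε : Fin 2) (E : ℝ) : (M.γ ε E).re = M.density ε E / 2 := by
  have : 2 * (M.γ ε E).re = M.density ε E :=
    two_mul_re_halfFourierInt (M.inner_S_S_g ε) (M.integrable_corr ε) E
  linarith

lemma re_γ_nonneg (ε : Fin 2) (E : ℝ) : 0 ≤ (M.γ ε E).re := by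
  rw [re_γ]
  have := M.density_nonneg ε E
  positivity

/-- A lower bound of the one-particle energy. -/
def energyBound : ℝ := M.bddBelow_ω.some

/-- The thermal density `⟨g_ε, P_E L² g_ε⟩`. -/
def thermal (ε : Fin 2) (E : ℝ) : ℝ :=
  Real.exp (-(M.β * M.energyBound)) * Real.exp (-(M.β * |E + M.shift ε - M.energyBound|)) *
    (1 / (2 * Real.pi)) * M.density ε E

lemma innerP_eq_thermal (ε : Fin 2) (E : ℝ) :
    M.innerP (M.g ε) (M.L (M.L (M.g ε))) E = M.thermal ε E := by
  rw [M.innerP_L_L (fun k => M.bddBelow_ω.some_mem ⟨k, rfl⟩) ε (M.integrable_corr ε) E,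
    ← ofReal_density, ← Complex.ofReal_mul]
  rfl

lemma thermal_nonneg (ε : Fin 2) (E : ℝ) : 0 ≤ M.thermal ε E :=
  mul_nonneg (by positivity) (M.density_nonneg ε E)

lemma thermal_pos {ε : Fin 2} {E : ℝ} (h : 0 < M.density ε E) : 0 < M.thermal ε E :=
  mul_pos (by positivity) h

lemma continuous_thermal (ε : Fin 2) : Continuous (M.thermal ε) := by
  have := M.continuous_density ε
  unfold thermal
  fun_prop

lemma integrable_thermal (ε : Fin 2) : Integrable (M.thermal ε) := by
  have h2 := (integrable_exp_neg_abs M.β_pos).comp_add_right (M.shift ε - M.energyBound)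
  have h3 := (h2.const_mul (Real.exp (-(M.β * M.energyBound)) * (1 / (2 * Real.pi)))).mul_bdd
    (M.continuous_density ε).aestronglyMeasurable (.of_forall (M.norm_density_le ε))
  refine h3.congr (.of_forall fun E => ?_)
  simp only [thermal, add_sub_assoc]
  ring

lemma star_Dop (ε : Fin 2) : star (M.Dop ε) = M.Dop (1 - ε) := by
  fin_cases ε <;> simp [Dop]

lemma isUnit_one_add (ε : Fin 2) (E : ℝ) :
    IsUnit (1 + (M.γ ε E * M.γ (1 - ε) E) • (M.Dop ε * M.Dop (1 - ε))) := M.isUnit_T ε E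

lemma continuous_T (ε : Fin 2) : Continuous (M.T ε) := by
  have h1 := M.continuous_γ ε
  have h2 := M.continuous_γ (1 - ε)
  have h3 : Continuous fun E => 1 + (M.γ ε E * M.γ (1 - ε) E) • (M.Dop ε * M.Dop (1 - ε)) := by
    fun_prop
  rw [continuous_iff_continuousAt]
  intro E
  obtain ⟨x, hx⟩ := M.isUnit_one_add ε E
  have h4 := NormedRing.inverse_continuousAt x
  rw [hx] at h4
  exact ContinuousAt.comp (f := fun E => 1 + (M.γ ε E * M.γ (1 - ε) E) •
    (M.Dop ε * M.Dop (1 - ε))) h4 h3.continuousAt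

/-- Both factors γ vanish at infinity and inversion is continuous at 1. Together with
`continuous_T`, this upgrades pointwise invertibility to a bound uniform in E. -/
lemma tendsto_T (ε : Fin 2) : Tendsto (M.T ε) (cocompact ℝ) (𝓝 1) := by
  have h1 := (((M.tendsto_γ ε).mul (M.tendsto_γ (1 - ε))).smul_const
    (M.Dop ε * M.Dop (1 - ε))).const_add 1
  rw [mul_zero, zero_smul, add_zero] at h1
  have h4 := NormedRing.inverse_continuousAt (1 : (HS →L[ℂ] HS)ˣ)
  rw [ContinuousAt, Units.val_one, Ring.inverse_one] at h4
  exact h4.comp h1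

lemma T_apply (ε : Fin 2) (E : ℝ) (u : HS) :
    M.T ε E u + (M.γ ε E * M.γ (1 - ε) E) • (M.Dop ε * M.Dop (1 - ε)) (M.T ε E u) = u := by
  have h := congrArg (fun X : HS →L[ℂ] HS => X u)
    (Ring.mul_inverse_cancel _ (M.isUnit_one_add ε E))
  exact h

lemma exists_bound_γ_T (ε : Fin 2) : ∃ C : ℝ, ∀ E,
    ‖M.γ (1 - ε) E • (M.Dop ε * M.Dop (1 - ε) * M.T ε E)‖ ≤ C := by
  have h1 := M.continuous_γ (1 - ε)
  have h2 := M.continuous_T ε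
  exact bounded_of_tendsto_cocompact (by fun_prop)
    ((M.tendsto_γ (1 - ε)).smul ((M.tendsto_T ε).const_mul _))

lemma drift_eq (ε : Fin 2) (E : ℝ) : M.drift ε E =
    M.thermal ε E • (M.γ (1 - ε) E • (M.Dop ε * M.Dop (1 - ε) * M.T ε E)) := by
  rw [drift, innerP_eq_thermal, mul_comm, mul_smul, Complex.coe_smul]

/-- An integrable scalar, the thermal density, times a bounded continuous operator-valued function.
-/
lemma integrable_drift (ε : Fin 2) : Integrable (M.drift ε) := by
  obtain ⟨C, hC⟩ := M.exists_bound_γ_T ε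
  have h1 := M.continuous_γ (1 - ε)
  have h2 := M.continuous_T ε
  have h3 : Continuous fun E => M.γ (1 - ε) E • (M.Dop ε * M.Dop (1 - ε) * M.T ε E) := by fun_prop
  exact ((M.integrable_thermal ε).smul_bdd C h3.aestronglyMeasurable (.of_forall hC)).congr
    (.of_forall fun E => (M.drift_eq ε E).symm)

/-- This is `re_inner_resolvent` with B = D_ε, z = γ_ε, z' = γ_{1-ε} and w = T_ε(E)u; by `T_apply`
the left argument is u itself. -/
lemma re_inner_drift (ε : Fin 2) (E : ℝ) (u : HS) :
    (⟪u, M.drift ε E u⟫_ℂ).re = M.thermal ε E *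
      ((M.γ (1 - ε) E).re * ‖M.Dop (1 - ε) (M.T ε E u)‖ ^ 2 +
        (M.γ ε E).re * ‖M.γ (1 - ε) E‖ ^ 2 *
          ‖(M.Dop ε * M.Dop (1 - ε)) (M.T ε E u)‖ ^ 2) := by
  have h := re_inner_resolvent (M.Dop ε) (M.γ ε E) (M.γ (1 - ε) E) (M.T ε E u)
  rw [star_Dop, T_apply] at h
  rw [← h, drift_eq, _root_.smul_apply, inner_smul_right_eq_smul, Complex.smul_re]
  rfl

lemma re_inner_drift_nonneg (ε : Fin 2) (E : ℝ) (u : HS) : 0 ≤ (⟪u, M.drift ε E u⟫_ℂ).re := by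
  rw [re_inner_drift]
  have h1 := M.thermal_nonneg ε E
  have h2 := M.re_γ_nonneg ε E
  have h3 := M.re_γ_nonneg (1 - ε) E
  positivity

/-- The functional `X ↦ ⟨u, X v⟩`. -/
def matrixElement (u v : HS) : (HS →L[ℂ] HS) →L[ℂ] ℂ :=
  innerSL ℂ u ∘L ContinuousLinearMap.apply ℂ HS v

lemma integrable_inner_drift (ε : Fin 2) (u v : HS) :
    Integrable fun E => ⟪u, M.drift ε E v⟫_ℂ :=
  (matrixElement u v).integrable_comp (M.integrable_drift ε)

lemma inner_Γ (u v : HS) : ⟪u, M.Γ v⟫_ℂ = ∑ ε : Fin 2, ∫ E, ⟪u, M.drift ε E v⟫_ℂ := by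
  have h : ⟪u, M.Γ v⟫_ℂ = matrixElement u v M.Γ := rfl
  rw [h, Γ, map_sum]
  refine Finset.sum_congr rfl fun ε _ => ?_
  rw [← ContinuousLinearMap.integral_comp_comm _ (M.integrable_drift ε)]
  rfl

lemma re_inner_Γ (u : HS) : (⟪u, M.Γ u⟫_ℂ).re = ∑ ε : Fin 2, ∫ E, (⟪u, M.drift ε E u⟫_ℂ).re := by
  rw [inner_Γ, Complex.re_sum]
  refine Finset.sum_congr rfl fun ε _ => ?_
  exact (integral_re (M.integrable_inner_drift ε u u)).symm

lemma re_inner_Γ_nonneg (u : HS) : 0 ≤ (⟪u, M.Γ u⟫_ℂ).re := by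
  rw [re_inner_Γ]
  exact Finset.sum_nonneg fun ε _ => integral_nonneg fun E => M.re_inner_drift_nonneg ε E u

/-- A lower bound of the damping density, in units of `‖D_ε D_{1-ε} u‖²`. -/
def damping (ε : Fin 2) (E : ℝ) : ℝ :=
  M.thermal ε E * ((M.γ ε E).re * ‖M.γ (1 - ε) E‖ ^ 2 /
    (1 + ‖M.γ ε E * M.γ (1 - ε) E‖ * ‖M.Dop ε * M.Dop (1 - ε)‖) ^ 2)

lemma damping_nonneg (ε : Fin 2) (E : ℝ) : 0 ≤ M.damping ε E := by
  have h1 := M.thermal_nonneg ε E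
  have h2 := M.re_γ_nonneg ε E
  unfold damping
  positivity

/-- Only the second summand of `re_inner_drift` is kept, since it needs no overlap of the two
spectral densities. With A = D_ε D_{1-ε}, the vector Au = (1 + zA)Aw is controlled by Aw, which
replaces w = T_ε(E)u by u. -/
lemma damping_mul_le (ε : Fin 2) (E : ℝ) (u : HS) :
    M.damping ε E * ‖(M.Dop ε * M.Dop (1 - ε)) u‖ ^ 2 ≤ (⟪u, M.drift ε E u⟫_ℂ).re := by
  set A := M.Dop ε * M.Dop (1 - ε) with hA
  set w := M.T ε E u with hw
  set z := M.γ ε E * M.γ (1 - ε) E with hz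
  have h1 : ‖A u‖ ≤ (1 + ‖z‖ * ‖A‖) * ‖A w‖ := by
    have : A u = A w + z • A (A w) := by
      rw [← map_smul, ← map_add, hw, hz, hA, M.T_apply ε E u]
    rw [this]
    refine (norm_add_le _ _).trans ?_
    rw [norm_smul, add_mul, one_mul, mul_assoc]
    gcongr
    exact A.le_opNorm _
  have h2 := M.thermal_nonneg ε E
  have h3 := M.re_γ_nonneg ε E
  have h4 := M.re_γ_nonneg (1 - ε) E
  have h5 : ‖A u‖ ^ 2 / (1 + ‖z‖ * ‖A‖) ^ 2 ≤ ‖A w‖ ^ 2 := by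
    rw [div_le_iff₀ (by positivity), ← mul_pow, mul_comm]
    exact pow_le_pow_left₀ (norm_nonneg _) h1 2
  rw [re_inner_drift, damping, mul_assoc]
  refine mul_le_mul_of_nonneg_left ?_ h2
  calc (M.γ ε E).re * ‖M.γ (1 - ε) E‖ ^ 2 / (1 + ‖z‖ * ‖A‖) ^ 2 * ‖A u‖ ^ 2
      = (M.γ ε E).re * ‖M.γ (1 - ε) E‖ ^ 2 * (‖A u‖ ^ 2 / (1 + ‖z‖ * ‖A‖) ^ 2) := by ring
    _ ≤ (M.γ ε E).re * ‖M.γ (1 - ε) E‖ ^ 2 * ‖A w‖ ^ 2 := by gcongr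
    _ ≤ _ := le_add_of_nonneg_left (by positivity)

lemma continuous_damping (ε : Fin 2) : Continuous (M.damping ε) := by
  have h1 := M.continuous_thermal ε
  have h2 := M.continuous_γ ε
  have h3 := M.continuous_γ (1 - ε)
  refine h1.mul (Continuous.div (by fun_prop) (by fun_prop) fun E => ?_)
  positivity

lemma integrable_damping (ε : Fin 2) : Integrable (M.damping ε) := by
  obtain ⟨C, hC⟩ := bounded_of_tendsto_cocompact (M.continuous_γ ε) (M.tendsto_γ ε)
  obtain ⟨C', hC'⟩ := bounded_of_tendsto_cocompact (M.continuous_γ (1 - ε))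
    (M.tendsto_γ (1 - ε))
  refine ((M.integrable_thermal ε).mul_const (C * C' ^ 2)).mono'
    (M.continuous_damping ε).aestronglyMeasurable (.of_forall fun E => ?_)
  rw [Real.norm_of_nonneg (M.damping_nonneg ε E)]
  refine mul_le_mul_of_nonneg_left ?_ (M.thermal_nonneg ε E)
  have h3 := M.re_γ_nonneg ε E
  refine (div_le_self (by positivity) ?_).trans ?_
  · refine one_le_pow₀ (le_add_of_nonneg_right (by positivity))
  · exact mul_le_mul ((Complex.re_le_norm _).trans (hC E))
      (pow_le_pow_left₀ (norm_nonneg _) (hC' E) 2) (by positivity)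
      ((norm_nonneg _).trans (hC E))

lemma corr_zero_ne_zero {ε : Fin 2} (h : M.g ε ≠ 0) : M.corr ε 0 ≠ 0 := by
  rw [Reservoir.corr, Reservoir.S_zero]
  exact inner_self_ne_zero.2 h

/-- The density of g_ε is positive on an open interval, and γ_{1-ε} is nonzero somewhere in it;
there the continuous integrand is positive. -/
lemma integral_damping_pos (hg : ∀ ε, M.g ε ≠ 0) (ε : Fin 2) : 0 < ∫ E, M.damping ε E := by
  obtain ⟨E₀, hE₀⟩ := exists_fourierInt_ne_zero (M.inner_S_S_g ε) (M.continuous_corr ε)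
    (M.integrable_corr ε) (M.corr_zero_ne_zero (hg ε))
  have hpos : 0 < M.density ε E₀ := by
    refine (M.density_nonneg ε E₀).lt_of_ne fun h => hE₀ ?_
    rw [← ofReal_density, ← h, Complex.ofReal_zero]
  obtain ⟨r, hr, hball⟩ := Metric.isOpen_iff.1
    (isOpen_lt continuous_const (M.continuous_density ε)) E₀ hpos
  rw [Real.ball_eq_Ioo] at hball
  obtain ⟨E₁, hE₁, hne⟩ := exists_halfFourierInt_ne_zero (M.inner_S_S_g (1 - ε))
    (M.continuous_corr (1 - ε)) (M.integrable_corr (1 - ε)) (M.corr_zero_ne_zero (hg (1 - ε)))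
    (show E₀ - r < E₀ + r by linarith)
  have hd : 0 < M.density ε E₁ := hball hE₁
  have h1 : 0 < M.damping ε E₁ := by
    have h2 := M.thermal_pos hd
    have h3 : 0 < (M.γ ε E₁).re := by rw [re_γ]; positivity
    have h4 : 0 < ‖M.γ (1 - ε) E₁‖ := norm_pos_iff.2 hne
    unfold damping
    positivity
  rw [integral_pos_iff_support_of_nonneg (M.damping_nonneg ε) (M.integrable_damping ε)]
  exact (M.continuous_damping ε).isOpen_support.measure_pos _ ⟨E₁, h1.ne'⟩

/-- D_ε is the adjoint of D_{1-ε}, so the left side is ⟨u, D_ε D_{1-ε}u⟩; then Cauchy–Schwarz. -/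
lemma sq_norm_Dop_le (ε : Fin 2) (u : HS) :
    ‖M.Dop (1 - ε) u‖ ^ 2 ≤ ‖(M.Dop ε * M.Dop (1 - ε)) u‖ * ‖u‖ := by
  have h : ⟪u, (M.Dop ε * M.Dop (1 - ε)) u⟫_ℂ = ((‖M.Dop (1 - ε) u‖ ^ 2 : ℝ) : ℂ) := by
    rw [ContinuousLinearMap.mul_def, ContinuousLinearMap.comp_apply,
      ← ContinuousLinearMap.adjoint_inner_left, ← ContinuousLinearMap.star_eq_adjoint, star_Dop,
      inner_self_eq_norm_sq_to_K]
    norm_cast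
  have h1 := norm_inner_le_norm (𝕜 := ℂ) u ((M.Dop ε * M.Dop (1 - ε)) u)
  rw [h, Complex.norm_real, Real.norm_of_nonneg (by positivity), mul_comm] at h1
  exact h1

lemma Γ_coercive (hg : ∀ ε, M.g ε ≠ 0) {δ : ℝ} (hδ : 0 < δ)
    (hD : ∀ u : HS, δ * ‖u‖ ≤ ‖M.Dop 0 u‖ + ‖M.Dop 1 u‖) :
    ∃ c : ℝ, 0 < c ∧ ∀ u : HS, c * ‖u‖ ^ 2 ≤ (⟪u, M.Γ u⟫_ℂ).re := by
  set m := min (∫ E, M.damping 0 E) (∫ E, M.damping 1 E) with hm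
  have hmpos : 0 < m := lt_min (M.integral_damping_pos hg 0) (M.integral_damping_pos hg 1)
  -- With x, y the norms of D_0 u, D_1 u and a, b those of D_0 D_1 u, D_1 D_0 u: δ²‖u‖² ≤ (x + y)² ≤
  -- 2(x² + y²) ≤ 2(a + b)‖u‖, so a + b ≥ (δ²/2)‖u‖ and a² + b² ≥ (a + b)²/2 ≥ (δ⁴/8)‖u‖².
  refine ⟨m * (δ ^ 4 / 8), by positivity, fun u => ?_⟩
  have h1 : ∀ ε : Fin 2, m * ‖(M.Dop ε * M.Dop (1 - ε)) u‖ ^ 2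
      ≤ ∫ E, (⟪u, M.drift ε E u⟫_ℂ).re := by
    intro ε
    have h2 : m ≤ ∫ E, M.damping ε E := by
      fin_cases ε
      · exact min_le_left _ _
      · exact min_le_right _ _
    refine (mul_le_mul_of_nonneg_right h2 (by positivity)).trans ?_
    rw [← integral_mul_const]
    exact integral_mono ((M.integrable_damping ε).mul_const _)
      (M.integrable_inner_drift ε u u).re fun E => M.damping_mul_le ε E u
  rw [re_inner_Γ, Fin.sum_univ_two]
  refine le_trans ?_ (add_le_add (h1 0) (h1 1))
  rw [← mul_add, mul_assoc]
  refine mul_le_mul_of_nonneg_left ?_ hmpos.le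
  have h3 := M.sq_norm_Dop_le 0 u
  have h4 := M.sq_norm_Dop_le 1 u
  have h5 := hD u
  rw [show (1 : Fin 2) - 0 = 1 from rfl] at *
  rw [show (1 : Fin 2) - 1 = 0 from rfl] at *
  set a := ‖(M.Dop 0 * M.Dop 1) u‖
  set b := ‖(M.Dop 1 * M.Dop 0) u‖
  set x := ‖M.Dop 0 u‖
  set y := ‖M.Dop 1 u‖
  rcases (norm_nonneg u).eq_or_lt with h0 | h0
  · rw [← h0]
    have : 0 ≤ a ^ 2 + b ^ 2 := by positivity
    simpa using this
  · have h6 : (δ * ‖u‖) ^ 2 ≤ (x + y) ^ 2 := pow_le_pow_left₀ (by positivity) h5 2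
    have h7 : δ ^ 2 / 2 * ‖u‖ ≤ a + b := by
      refine le_of_mul_le_mul_right ?_ h0
      nlinarith [sq_nonneg (x - y)]
    have h8 : (δ ^ 2 / 2 * ‖u‖) ^ 2 ≤ (a + b) ^ 2 := pow_le_pow_left₀ (by positivity) h7 2
    nlinarith [sq_nonneg (a - b)]

end LowDensityModel


/-! ### Weak uniqueness and decay for a bounded generator. -/

section Semigroup
variable {HS : Type*} [NormedAddCommGroup HS] [InnerProductSpace ℂ HS] [CompleteSpace HS]

lemma hasDerivAt_exp_neg_smul (G : HS →L[ℂ] HS) (v : HS) (t : ℝ) :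
    HasDerivAt (fun t : ℝ => NormedSpace.exp ((-t : ℂ) • G) v)
      (-(G (NormedSpace.exp ((-t : ℂ) • G) v))) t := by
  let +nondep : NormedAlgebra ℚ (HS →L[ℂ] HS) := .restrictScalars ℚ ℂ _
  have h1 := (hasDerivAt_exp_smul_const' (𝕂 := ℂ) (-G) (t : ℂ)).scomp t
    Complex.ofRealCLM.hasDerivAt
  have h2 := ((ContinuousLinearMap.apply ℂ HS v).restrictScalars ℝ).hasFDerivAt.comp_hasDerivAt t h1
  have h3 : ∀ z : ℂ, z • (-G) = (-z) • G := fun z => by rw [smul_neg, neg_smul]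
  refine (h2.congr_deriv ?_).congr_of_eventuallyEq (.of_forall fun s => ?_)
  · simp [h3]
  · simp [h3]

/-- A weakly integrable solution of `x_t = -∫₀ᵗ G x_s ds` vanishes. -/
lemma eq_zero_of_weak_integral_eq (G : HS →L[ℂ] HS) (x : ℝ → HS) {τ : ℝ}
    (hint : ∀ u, IntervalIntegrable (fun s => ⟪u, x s⟫_ℂ) volume 0 τ)
    (hx : ∀ u, ∀ t ∈ Set.Icc 0 τ, ⟪u, x t⟫_ℂ = -∫ s in (0 : ℝ)..t, ⟪u, G (x s)⟫_ℂ) :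
    ∀ t ∈ Set.Icc 0 τ, x t = 0 := by
  rcases lt_or_ge τ 0 with hτ | hτ
  · intro t ht; exact absurd (ht.1.trans ht.2) (not_le.2 hτ)
  have hx' : ∀ u, ∀ t ∈ Set.Icc 0 τ, ⟪u, x t⟫_ℂ = -∫ s in (0 : ℝ)..t, ⟪star G u, x s⟫_ℂ := by
    intro u t ht
    simp only [ContinuousLinearMap.star_eq_adjoint, ContinuousLinearMap.adjoint_inner_left]
    exact hx u t ht
  -- No norm bound or strong measurability of x is given. The weak equation bounds each ⟨u, x_t⟩
  -- uniformly in t, and Banach–Steinhaus makes this a norm bound.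
  have hbdd : ∀ u, ∃ C, ∀ t : Set.Icc 0 τ, ‖innerSL ℂ (x t) u‖ ≤ C := by
    intro u
    refine ⟨∫ s in (0 : ℝ)..τ, ‖⟪star G u, x s⟫_ℂ‖, fun t => ?_⟩
    rw [innerSL_apply_apply, norm_inner_symm, hx' u t t.2, norm_neg]
    refine (intervalIntegral.norm_integral_le_integral_norm t.2.1).trans ?_
    exact intervalIntegral.integral_mono_interval le_rfl t.2.1 t.2.2
      (.of_forall fun _ => norm_nonneg _) (hint _).norm
  obtain ⟨C, hC⟩ := banach_steinhaus hbdd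
  have hC' : ∀ t ∈ Set.Icc 0 τ, ‖x t‖ ≤ C := fun t ht => by
    simpa using hC ⟨t, ht⟩
  -- Picard iteration in weak form: each step replaces u by G⁺u, which costs a factor ‖G⁺‖ and one
  -- time integration.
  have hiter : ∀ n : ℕ, ∀ u, ∀ t ∈ Set.Icc 0 τ,
      ‖⟪u, x t⟫_ℂ‖ ≤ C * ‖u‖ * ((‖star G‖ * t) ^ n / n.factorial) := by
    intro n
    induction n with
    | zero =>
      intro u t ht
      simp only [pow_zero, Nat.factorial_zero, Nat.cast_one, div_one, mul_one]
      refine (norm_inner_le_norm _ _).trans ?_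
      rw [mul_comm]
      exact mul_le_mul_of_nonneg_right (hC' t ht) (norm_nonneg _)
    | succ n ih =>
      intro u t ht
      have hC0 : 0 ≤ C := (norm_nonneg _).trans (hC' t ht)
      rw [hx' u t ht, norm_neg]
      have h1 : ∀ s ∈ Set.Ioc 0 t, ‖⟪star G u, x s⟫_ℂ‖
          ≤ C * ‖u‖ * (‖star G‖ ^ (n + 1) / n.factorial) * s ^ n := by
        intro s hs
        refine (ih (star G u) s ⟨hs.1.le, hs.2.trans ht.2⟩).trans ?_
        have h2 := (star G).le_opNorm u
        have hs0 := hs.1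
        calc C * ‖star G u‖ * ((‖star G‖ * s) ^ n / n.factorial)
            ≤ C * (‖star G‖ * ‖u‖) * ((‖star G‖ * s) ^ n / n.factorial) := by gcongr
          _ = _ := by rw [mul_pow]; ring
      refine (intervalIntegral.norm_integral_le_of_norm_le ht.1 (.of_forall h1)
        (Continuous.intervalIntegrable (by fun_prop) 0 t)).trans_eq ?_
      rw [intervalIntegral.integral_const_mul, integral_pow, Nat.factorial_succ]
      push_cast
      have : ((n.factorial : ℝ)) ≠ 0 := by positivity
      field_simp
      simp only [ne_eq, Nat.add_eq_zero_iff, one_ne_zero, and_false, not_false_eq_true, zero_pow,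
        sub_zero]
      ring
  intro t ht
  have h0 : ‖⟪x t, x t⟫_ℂ‖ ≤ 0 := by
    have h1 := ((FloorSemiring.tendsto_pow_div_factorial_atTop (‖star G‖ * t)).const_mul
      (C * ‖x t‖))
    rw [mul_zero] at h1
    exact ge_of_tendsto' h1 fun n => hiter n (x t) t ht
  exact inner_self_eq_zero.1 (norm_le_zero_iff.1 h0)

/-- A weakly integrable solution of `V_t = 1 - ∫₀ᵗ G V_s ds` is `exp(-t G)`. -/
lemma eq_exp_of_weak_integral_eq (G : HS →L[ℂ] HS) (V : ℝ → HS →L[ℂ] HS)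
    (hint : ∀ u v, ∀ t : ℝ, 0 ≤ t → IntervalIntegrable (fun s => ⟪u, G (V s v)⟫_ℂ) volume 0 t)
    (hV : ∀ u v, ∀ t : ℝ, 0 ≤ t → ⟪u, V t v⟫_ℂ = ⟪u, v⟫_ℂ - ∫ s in (0 : ℝ)..t, ⟪u, G (V s v)⟫_ℂ)
    {t : ℝ} (ht : 0 ≤ t) : V t = NormedSpace.exp ((-t : ℂ) • G) := by
  ext1 v
  set y : ℝ → HS := fun t => NormedSpace.exp ((-t : ℂ) • G) v with hy
  have hyd : ∀ t, HasDerivAt y (-(G (y t))) t := hasDerivAt_exp_neg_smul G v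
  have hyc : Continuous y := continuous_iff_continuousAt.2 fun t => (hyd t).continuousAt
  have hy0 : y 0 = v := by simp [hy]
  have hyi : ∀ u, ∀ t : ℝ, ⟪u, y t⟫_ℂ = ⟪u, v⟫_ℂ - ∫ s in (0 : ℝ)..t, ⟪u, G (y s)⟫_ℂ := by
    intro u t
    have hd : ∀ s ∈ Set.uIcc 0 t, HasDerivAt (fun s => ⟪u, y s⟫_ℂ) (-⟪u, G (y s)⟫_ℂ) s := by
      intro s _
      have := ((innerSL ℂ u).restrictScalars ℝ).hasFDerivAt.comp_hasDerivAt s (hyd s)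
      simpa using! this
    have hcont : Continuous fun s => -⟪u, G (y s)⟫_ℂ := by fun_prop
    have := intervalIntegral.integral_eq_sub_of_hasDerivAt hd (hcont.intervalIntegrable 0 t)
    rw [intervalIntegral.integral_neg, hy0] at this
    linear_combination -this
  -- The hypothesis gives integrability only of ⟨u, G V_s v⟩; for ⟨u, V_s v⟩ it follows from the
  -- equation, which exhibits this function as a continuous primitive.
  have hVi : ∀ u, IntervalIntegrable (fun s => ⟪u, V s v⟫_ℂ) volume 0 t := by
    intro u
    have hp : ContinuousOn (fun s => ⟪u, v⟫_ℂ - ∫ r in (0 : ℝ)..s, ⟪u, G (V r v)⟫_ℂ)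
        (Set.uIcc 0 t) :=
      continuousOn_const.sub (intervalIntegral.continuousOn_primitive_interval
        (by
          have := (hint u v t ht)
          rw [intervalIntegrable_iff'] at this
          exact this))
    refine (hp.congr fun s hs => ?_).intervalIntegrable
    rw [Set.uIcc_of_le ht] at hs
    exact hV u v s hs.1
  have key := eq_zero_of_weak_integral_eq G (fun s => V s v - y s) (τ := t) (fun u => ?_)
    (fun u s hs => ?_) t ⟨ht, le_rfl⟩
  · exact sub_eq_zero.1 key
  · simp only [inner_sub_right]
    exact (hVi u).sub ((by fun_prop : Continuous fun s => ⟪u, y s⟫_ℂ).intervalIntegrable 0 t)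
  · simp only [inner_sub_right, map_sub]
    rw [intervalIntegral.integral_sub (hint u v s hs.1)
      ((by fun_prop : Continuous fun s => ⟪u, G (y s)⟫_ℂ).intervalIntegrable 0 s), hV u v s hs.1,
      hyi u s]
    ring

/-- The semigroup of a coercive generator decays exponentially. -/
lemma norm_exp_neg_smul_le (G : HS →L[ℂ] HS) {c : ℝ}
    (hG : ∀ u : HS, c * ‖u‖ ^ 2 ≤ (⟪u, G u⟫_ℂ).re) {t : ℝ} (ht : 0 ≤ t) :
    ‖NormedSpace.exp ((-t : ℂ) • G)‖ ≤ Real.exp (-(c * t)) := by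
  refine ContinuousLinearMap.opNorm_le_bound _ (Real.exp_pos _).le fun v => ?_
  set y : ℝ → HS := fun t => NormedSpace.exp ((-t : ℂ) • G) v with hy
  have hyd : ∀ t, HasDerivAt y (-(G (y t))) t := hasDerivAt_exp_neg_smul G v
  have hn : ∀ s, HasDerivAt (fun s => ‖y s‖ ^ 2) (-(2 * (⟪y s, G (y s)⟫_ℂ).re)) s := by
    intro s
    have h1 := (hyd s).inner ℂ (hyd s)
    have h2 := Complex.reCLM.hasFDerivAt.comp_hasDerivAt s h1
    have h3 : (Complex.reCLM ∘ fun s => ⟪y s, y s⟫_ℂ) = fun s => ‖y s‖ ^ 2 := by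
      ext s
      exact inner_self_eq_norm_sq (𝕜 := ℂ) (y s)
    rw [h3] at h2
    refine h2.congr_deriv ?_
    have h4 : (⟪G (y s), y s⟫_ℂ).re = (⟪y s, G (y s)⟫_ℂ).re :=
      inner_re_symm (𝕜 := ℂ) _ _
    rw [inner_neg_left, inner_neg_right, Complex.reCLM_apply, Complex.add_re, Complex.neg_re,
      Complex.neg_re, h4]
    ring
  have hd : ∀ s, HasDerivAt (fun s => Real.exp (2 * c * s) * ‖y s‖ ^ 2)
      (Real.exp (2 * c * s) * (2 * c) * ‖y s‖ ^ 2
        + Real.exp (2 * c * s) * -(2 * (⟪y s, G (y s)⟫_ℂ).re)) s := by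
    intro s
    have h1 : HasDerivAt (fun s => Real.exp (2 * c * s)) (Real.exp (2 * c * s) * (2 * c)) s := by
      simpa using ((hasDerivAt_id s).const_mul (2 * c)).exp
    exact h1.mul (hn s)
  -- Energy estimate: d/ds ‖y‖² = -2 Re⟨y, Gy⟩ ≤ -2c‖y‖², so the weight exp(2cs) leaves a
  -- non-increasing function.
  have hanti : Antitone fun s => Real.exp (2 * c * s) * ‖y s‖ ^ 2 := by
    refine antitone_of_hasDerivAt_nonpos hd fun s => ?_
    have h1 := mul_le_mul_of_nonneg_left (hG (y s)) (Real.exp_pos (2 * c * s)).le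
    change Real.exp (2 * c * s) * (2 * c) * ‖y s‖ ^ 2
        + Real.exp (2 * c * s) * -(2 * (⟪y s, G (y s)⟫_ℂ).re) ≤ 0
    linarith
  have h1 := hanti ht
  have hy0 : y 0 = v := by simp [hy]
  simp only [mul_zero, Real.exp_zero, one_mul, hy0] at h1
  have h2 : ‖y t‖ ^ 2 ≤ (Real.exp (-(c * t)) * ‖v‖) ^ 2 := by
    rw [mul_pow, ← Real.exp_nat_mul]
    have h3 : Real.exp (((2 : ℕ) : ℝ) * -(c * t)) = (Real.exp (2 * c * t))⁻¹ := by
      rw [← Real.exp_neg]; congr 1; push_cast; ring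
    rw [h3, inv_mul_eq_div, le_div_iff₀ (Real.exp_pos _), mul_comm]
    exact h1
  exact (sq_le_sq₀ (norm_nonneg _) (by positivity)).1 h2

end Semigroup

/-! ### Matrix elements of amplified operators on the completed tensor product. -/

section Tensor
variable {HS V : Type*} [NormedAddCommGroup HS] [InnerProductSpace ℂ HS]
  [NormedAddCommGroup V] [InnerProductSpace ℂ V]

lemma inner_mapL_id [CompleteSpace HS] (X : HS →L[ℂ] HS) (u : HS) (x : V) (y : HS ⊗[ℂ] V) :
    ⟪u ⊗ₜ[ℂ] x, TensorProduct.mapL X (ContinuousLinearMap.id ℂ V) y⟫_ℂ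
      = ⟪(star X u) ⊗ₜ[ℂ] x, y⟫_ℂ := by
  induction y using TensorProduct.induction_on with
  | zero => simp
  | tmul v z =>
    rw [TensorProduct.mapL_tmul, TensorProduct.inner_tmul, TensorProduct.inner_tmul,
      ContinuousLinearMap.star_eq_adjoint, ContinuousLinearMap.adjoint_inner_left]
    rfl
  | add a b ha hb => rw [map_add, inner_add_right, inner_add_right, ha, hb]

lemma inner_completion_mapL_id [CompleteSpace HS] (X : HS →L[ℂ] HS) (u : HS) (x : V)
    (y : UniformSpace.Completion (HS ⊗[ℂ] V)) :
    ⟪((u ⊗ₜ[ℂ] x : HS ⊗[ℂ] V) : UniformSpace.Completion (HS ⊗[ℂ] V)),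
      (TensorProduct.mapL X (ContinuousLinearMap.id ℂ V)).completion y⟫_ℂ
      = ⟪(((star X u) ⊗ₜ[ℂ] x : HS ⊗[ℂ] V) : UniformSpace.Completion (HS ⊗[ℂ] V)), y⟫_ℂ := by
  induction y using UniformSpace.Completion.induction_on with
  | hp => exact isClosed_eq (by fun_prop) (by fun_prop)
  | ih y =>
    rw [ContinuousLinearMap.completion_apply_coe, UniformSpace.Completion.inner_coe,
      UniformSpace.Completion.inner_coe, inner_mapL_id]

lemma inner_completion_tmul (u v : HS) (x y : V) :
    ⟪((u ⊗ₜ[ℂ] x : HS ⊗[ℂ] V) : UniformSpace.Completion (HS ⊗[ℂ] V)),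
      ((v ⊗ₜ[ℂ] y : HS ⊗[ℂ] V) : UniformSpace.Completion (HS ⊗[ℂ] V))⟫_ℂ = ⟪u, v⟫_ℂ * ⟪x, y⟫_ℂ := by
  rw [UniformSpace.Completion.inner_coe, TensorProduct.inner_tmul]

end Tensor

lemma inner_vacuum_vacuum (V : Type) [NormedAddCommGroup V] [InnerProductSpace ℂ V] :
    ⟪vacuum V, vacuum V⟫_ℂ = 1 := by
  refine (KernelSpace.inner_vec _ (expKernel_posSemidef V) 0 0).trans ?_
  simp [expKernel]

/-! ### The equation between vacuum vectors. -/

namespace LowDensityModel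
variable {d : ℕ} {HS : Type*} [NormedAddCommGroup HS] [InnerProductSpace ℂ HS] [CompleteSpace HS]
variable (M : LowDensityModel d HS)

/-- The empty list is the zero test function, with exponential vector Ω. Its `bra` and `ket` are
empty sums, so six of the seven terms vanish, and X ⊗ 1 in the last one becomes X acting on the
vacuum expectation. -/
lemma normalRHS_vacuum (U : M.TotalSpace →L[ℂ] M.TotalSpace) (u v : HS) (t : ℝ) :
    M.normalRHS U u v [] [] t = -⟪u, M.Γ (M.vacuumExpectation U v)⟫_ℂ := by
  have hb : M.bra [] t = 0 := rfl
  have hk : M.ket [] t = 0 := by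
    ext ε ε' E
    exact map_zero (starRingEnd ℂ)
  have hm : M.matEl U u v [] [] = fun X => ⟪u, X (M.vacuumExpectation U v)⟫_ℂ :=
    funext fun X => (inner_completion_mapL_id X u (vacuum _) (U (M.tmul v (vacuum _)))).trans <|
      (M.inner_vacuumExpectation U (star X u) v).symm.trans <| by
        rw [ContinuousLinearMap.star_eq_adjoint, ContinuousLinearMap.adjoint_inner_left]
  unfold normalRHS
  generalize M.matEl U u v [] [] = m at hm
  generalize M.bra [] t = b at hb
  generalize M.ket [] t = k at hk
  generalize M.vacuumExpectation U v = w at hm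
  subst hb hk hm
  rw [inner_Γ]
  refine congrArg _ (Finset.sum_congr rfl fun ε _ => congrArg _ (funext fun E => ?_))
  simp only [Pi.zero_apply, mul_zero, Finset.sum_const_zero, zero_add]
  rw [drift, mul_comm (M.γ (1 - ε) E), mul_smul, _root_.smul_apply, _root_.smul_apply,
    inner_smul_right, inner_smul_right, _root_.smul_apply, inner_smul_right, mul_comm]

lemma vacuumExpectation_eq_exp {U : ℝ → M.TotalSpace →L[ℂ] M.TotalSpace} (hU : M.IsEvolution U)
    {t : ℝ} (ht : 0 ≤ t) : M.vacuumExpectation (U t) = NormedSpace.exp ((-t : ℂ) • M.Γ) := by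
  refine eq_exp_of_weak_integral_eq M.Γ (fun t => M.vacuumExpectation (U t)) (fun u v t ht => ?_)
    (fun u v t ht => ?_) ht
  · exact (hU u v [] [] t ht).1.neg.congr fun s _ =>
      (congrArg (- ·) (M.normalRHS_vacuum (U s) u v s)).trans (neg_neg _)
  · refine (M.inner_vacuumExpectation (U t) u v).trans <| (hU u v [] [] t ht).2.trans <|
      (congrArg₂ (· + ·) ?_ ?_).trans (sub_eq_add_neg _ _).symm
    · exact (inner_completion_tmul u v _ _).trans
        ((congrArg (⟪u, v⟫_ℂ * ·) (inner_vacuum_vacuum _)).trans (mul_one _))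
    · exact (intervalIntegral.integral_congr fun s _ => M.normalRHS_vacuum (U s) u v s).trans
        intervalIntegral.integral_neg

end LowDensityModel
end LowDensity
end
theorem mainTheorem5 {d : ℕ} {HS : Type*} [NormedAddCommGroup HS] [InnerProductSpace ℂ HS]
    [CompleteSpace HS] (M : LowDensity.LowDensityModel d HS)
    (U : ℝ → M.TotalSpace →L[ℂ] M.TotalSpace) (hU : M.IsEvolution U) :
    (∀ ε : Fin 2, MeasureTheory.Integrable (M.drift ε)) ∧
    (∀ t : ℝ, 0 ≤ t → M.vacuumExpectation (U t) = NormedSpace.exp ((-t : ℂ) • M.Γ)) ∧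
    (∀ u : HS, 0 ≤ (inner ℂ u (M.Γ u)).re) ∧
    ((∀ ε : Fin 2, M.g ε ≠ 0) →
      (∃ δ : ℝ, 0 < δ ∧ ∀ u : HS, δ * ‖u‖ ≤ ‖M.Dop 0 u‖ + ‖M.Dop 1 u‖) →
      ∃ c : ℝ, 0 < c ∧ ∀ t : ℝ, 0 ≤ t → ‖M.vacuumExpectation (U t)‖ ≤ Real.exp (-(c * t))) := by
  refine ⟨M.integrable_drift, fun t ht => M.vacuumExpectation_eq_exp hU ht, M.re_inner_Γ_nonneg,
    fun hg ⟨δ, hδ, hD⟩ => ?_⟩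
  obtain ⟨c, hc, hΓ⟩ := M.Γ_coercive hg hδ hD
  refine ⟨c, hc, fun t ht => ?_⟩
  rw [M.vacuumExpectation_eq_exp hU ht]
  exact LowDensity.norm_exp_neg_smul_le M.Γ hΓ ht
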